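/- Let $T>0$, let $1\le p<\infty$, and let $\alpha=m-1+\sigma$ with $m\in\mathbb N=\{1,2,\dots\}$ and $0<\sigma<1$. For $a>0$ let $$J^{a}v(t)=\frac1{\Gamma(a)}\int_0^t(t-s)^{a-1}v(s)\,ds,\qquad 0<t<T,\ v\in L^1(0,T).$$ All functions are real-valued and all derivatives in Sobolev spaces are weak derivatives on $(0,T)$. For an integer $n\ge0$, $W^{n,p}(0,T)$ is the space of $u\in L^p(0,T)$ with $\frac{d^ku}{dt^k}\in L^p(0,T)$ for $0\le k\le n$, with the norm $\|u\|_{W^{n,p}(0,T)}=\sum_{k=0}^n\big\|\frac{d^ku}{dt^k}\big\|_{L^p(0,T)}$. For $\beta=n+\tau$ with an integer $n\ge 0$ and $0<\tau<1$, $W^{\beta,p}(0,T)$ is the space of $u\in W^{n,p}(0,T)$ for which $$\|u\|_{W^{\beta,p}(0,T)}=\left(\|u\|_{W^{n,p}(0,T)}^p+\int_0^T\!\!\int_0^T\frac{\big|\frac{d^{n}u}{dt^{n}}(t)-\frac{d^{n}u}{dt^{n}}(s)\big|^p}{|t-s|^{1+\tau p}}\,dt\,ds\right)^{1/p}$$ is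 finite, and ${}_0W^{\beta,p}(0,T)$ is the closure in $W^{\beta,p}(0,T)$ of $${}_0C^{n+1}[0,T]=\Big\{v\in C^{n+1}[0,T]:\ \frac{d^kv}{dt^k}(0)=0\ \text{ for } k=0,1,\dots,n\Big\}.$$ **Lemma 2.4.** Let $0<\varepsilon<1-\sigma$. Then there exists a constant $C>0$, depending only on $T$, $p$, $\alpha$ and $\varepsilon$, such that for all $u\in{}_0W^{\alpha+\varepsilon,p}(0,T)$ one has $J^{m-\alpha}u\in W^{m,p}(0,T)$ and $$\|J^{m-\alpha}u\|_{W^{m,p}(0,T)}\le C\,\|u\|_{W^{\alpha+\varepsilon,p}(0,T)}.$$ -/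

import Mathlib

open MeasureTheory Set
open scoped ENNReal ContDiff

noncomputable section

namespace FracSobolev

/-- The Riemann-Liouville fractional integral
`J^a v(t) = Γ(a)⁻¹ ∫₀ᵗ (t - s)^(a - 1) v(s) ds`, `a > 0`. -/
def fracInt (a : ℝ) (v : ℝ → ℝ) (t : ℝ) : ℝ :=
  1 / Real.Gamma a * ∫ s in (0 : ℝ)..t, (t - s) ^ (a - 1) * v s

/-- `g` is a `k`-th weak derivative of `u` on the interval `(0,T)`. -/
def HasWeakDeriv (T : ℝ) (k : ℕ) (u g : ℝ → ℝ) : Prop :=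
  LocallyIntegrableOn u (Ioo 0 T) ∧ LocallyIntegrableOn g (Ioo 0 T) ∧
    ∀ φ : ℝ → ℝ, ContDiff ℝ ∞ φ → HasCompactSupport φ → tsupport φ ⊆ Ioo 0 T →
      ∫ t in Ioo 0 T, u t * iteratedDeriv k φ t = (-1) ^ k * ∫ t in Ioo 0 T, g t * φ t

open Classical in
/-- The `k`-th weak derivative of `u` on `(0,T)`: a representative of it, which is unique up to
equality almost everywhere on `(0,T)`; by convention `0` if `u` has no such derivative. -/
def weakDeriv (T : ℝ) (k : ℕ) (u : ℝ → ℝ) : ℝ → ℝ :=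
  if h : ∃ g, HasWeakDeriv T k u g then h.choose else 0

/-- `u ∈ W^{m,p}(0,T)` for an integer `m ≥ 0`: for every `k ≤ m` the weak derivative of order `k`
exists and lies in `L^p(0,T)`. -/
def MemSobolev (T : ℝ) (m : ℕ) (p : ℝ) (u : ℝ → ℝ) : Prop :=
  ∀ k ≤ m, ∃ g, HasWeakDeriv T k u g ∧
    MemLp g (ENNReal.ofReal p) (volume.restrict (Ioo 0 T))

/-- The norm of `W^{m,p}(0,T)` for an integer `m ≥ 0`: the sum of the `L^p(0,T)` norms of the
weak derivatives of the orders `0, …, m`. -/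
def sobolevNorm (T : ℝ) (m : ℕ) (p : ℝ) (u : ℝ → ℝ) : ℝ≥0∞ :=
  ∑ k ∈ Finset.range (m + 1),
    eLpNorm (weakDeriv T k u) (ENNReal.ofReal p) (volume.restrict (Ioo 0 T))

/-- The double integral `∫₀ᵀ ∫₀ᵀ |g(t) - g(s)|^p / |t - s|^(1 + τ p) dt ds`. -/
def gagliardo (T τ p : ℝ) (g : ℝ → ℝ) : ℝ≥0∞ :=
  ∫⁻ s in Ioo 0 T, ∫⁻ t in Ioo 0 T,
    ENNReal.ofReal (|g t - g s| ^ p / |t - s| ^ (1 + τ * p))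

/-- The norm of the Sobolev-Slobodecki space `W^{β,p}(0,T)` for a real `β > 0`, `β ∉ ℕ`.
With `β = n + τ`, `n` an integer and `0 < τ < 1`, it is
`(‖u‖_{W^{n,p}}^p + ∬ |u⁽ⁿ⁾(t) - u⁽ⁿ⁾(s)|^p / |t - s|^(1 + τ p) dt ds)^(1/p)`. -/
def slobodeckiNorm (T β p : ℝ) (u : ℝ → ℝ) : ℝ≥0∞ :=
  (sobolevNorm T ⌊β⌋₊ p u ^ p + gagliardo T (Int.fract β) p (weakDeriv T ⌊β⌋₊ u)) ^ (1 / p)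

/-- `u ∈ W^{β,p}(0,T)` for a real `β > 0`, `β ∉ ℕ`. -/
def MemSlobodecki (T β p : ℝ) (u : ℝ → ℝ) : Prop :=
  MemSobolev T ⌊β⌋₊ p u ∧ slobodeckiNorm T β p u < ⊤

/-- `v ∈ ₀C^m[0,T]`: `v` is of class `C^m` on the closed interval `[0,T]` (one-sided derivatives
at the endpoints), and its derivatives of the orders `0, …, m - 1` vanish at `0`. -/
def MemZeroC (T : ℝ) (m : ℕ) (v : ℝ → ℝ) : Prop :=
  ContDiffOn ℝ m v (Icc 0 T) ∧ ∀ k < m, iteratedDerivWithin k v (Icc 0 T) 0 = 0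

/-- `u ∈ ₀W^{β,p}(0,T)` for a real `β = m - 1 + τ`, `m ≥ 1` an integer and `0 < τ < 1`: the
closure of `₀C^m[0,T]` in `W^{β,p}(0,T)`. -/
def MemZeroSlobodecki (T β p : ℝ) (u : ℝ → ℝ) : Prop :=
  MemSlobodecki T β p u ∧
    ∀ δ : ℝ≥0∞, 0 < δ → ∃ v, MemZeroC T (⌊β⌋₊ + 1) v ∧ slobodeckiNorm T β p (u - v) < δ

end FracSobolev

end

/-!
Write `n = m - 1`, `β = α + ε = n + τ` with `τ = σ + ε`, and `J = J^(1 - σ)`. The estimate is first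
proved for `v` in `₀C^m[0,T]` and then extended by density.

For such `v` one has `dᵏ/dtᵏ (J v) = J v⁽ᵏ⁾` for `k ≤ m` (`MemZeroC.hasWeakDeriv_fracInt`):
extended by `0` to the left of the origin, `v` keeps its weak derivatives up to the order `m`, and
`J` is a convolution with an integrable kernel on `(0,T)`. For `k ≤ n`, Young's inequality bounds
`J v⁽ᵏ⁾` in `L^p` by `v⁽ᵏ⁾` (`exists_eLpNorm_fracInt_le`). For `k = m`, put `w = v⁽ⁿ⁾`; as
`w(0) = 0`, integration by parts (`fracInt_deriv_eq`) gives

`Γ(1 - σ) J w'(t) = t^(-σ) w(t) + σ ∫₀ᵗ (w(t) - w(s)) (t - s)^(-1 - σ) ds`.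

The integral is controlled by the Gagliardo seminorm of order `τ > σ` through Jensen's inequality
(`exists_singular_le`). The term `t^(-σ) w(t)` is controlled by a fractional Hardy inequality
(`exists_hardy_le`), which holds for every order `ρ` with `ρ p ≠ 1`; since `σ < τ`, the critical
exponent can be avoided by taking `ρ = σ` or `ρ = τ`.

For `u` in the closure of `₀C^m[0,T]`, the functions `J v_j⁽ᵏ⁾` along an approximating sequence
`v_j` form a Cauchy sequence in `L^p(0,T)`; its limit is the weak derivative of `J u`, because
weak differentiation is closed, and it inherits the estimate (`exists_hasWeakDeriv_fracInt_le`).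
-/

namespace FracSobolev

open Filter Topology

/-! ### Jensen and Young inequalities, power kernels -/

/-- Jensen's inequality for the measure with density `k`, of any total mass. -/
theorem lintegral_mul_rpow_le {α : Type*} [MeasurableSpace α] {μ : Measure α} {h k : α → ℝ≥0∞}
    (hh : AEMeasurable h μ) (hk : AEMeasurable k μ) {p : ℝ} (hp : 1 ≤ p) :
    (∫⁻ a, h a * k a ∂μ) ^ p ≤ (∫⁻ a, k a ∂μ) ^ (p - 1) * ∫⁻ a, h a ^ p * k a ∂μ := by
  have hp0 : 0 < p := by linarith
  have hp1 : 0 ≤ 1 - 1 / p := by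
    rw [sub_nonneg, div_le_one hp0]; exact hp
  have key := ENNReal.lintegral_mul_norm_pow_le (μ := μ) (f := fun a => h a ^ p * k a) (g := k)
    ((hh.pow_const p).mul hk) hk (p := 1 / p) (q := 1 - 1 / p) (by positivity) hp1 (by ring)
  have e : ∀ a, (h a ^ p * k a) ^ (1 / p) * k a ^ (1 - 1 / p) = h a * k a := by
    intro a
    rw [ENNReal.mul_rpow_of_nonneg _ _ (by positivity), ← ENNReal.rpow_mul,
      mul_one_div_cancel hp0.ne', ENNReal.rpow_one, mul_assoc,
      ← ENNReal.rpow_add_of_nonneg _ _ (by positivity) hp1]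
    simp
  simp only [e] at key
  calc (∫⁻ a, h a * k a ∂μ) ^ p
      ≤ ((∫⁻ a, h a ^ p * k a ∂μ) ^ (1 / p) * (∫⁻ a, k a ∂μ) ^ (1 - 1 / p)) ^ p :=
        ENNReal.rpow_le_rpow key hp0.le
    _ = _ := by
        rw [ENNReal.mul_rpow_of_nonneg _ _ hp0.le, ← ENNReal.rpow_mul, ← ENNReal.rpow_mul,
          one_div_mul_cancel hp0.ne', ENNReal.rpow_one, mul_comm]
        congr 2
        field_simp

theorem eLpNorm_rpow_eq_lintegral {α : Type*} [MeasurableSpace α] {μ : Measure α} {p : ℝ}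
    (hp : 1 ≤ p) (f : α → ℝ) :
    eLpNorm f (ENNReal.ofReal p) μ ^ p = ∫⁻ a, ‖f a‖ₑ ^ p ∂μ := by
  have hp0 : 0 < p := by linarith
  rw [eLpNorm_eq_lintegral_rpow_enorm_toReal (by simpa using hp0) ENNReal.ofReal_ne_top,
    ENNReal.toReal_ofReal hp0.le, ← ENNReal.rpow_mul, one_div_mul_cancel hp0.ne', ENNReal.rpow_one]

/-- Young's inequality `‖f * κ‖_p ≤ ‖κ‖₁ ‖f‖_p`, raised to the power `p`. -/
theorem lintegral_convolution_rpow_le {κ f : ℝ → ℝ≥0∞} (hκ : Measurable κ)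
    (hκ' : ∫⁻ r, κ r ≠ ⊤) (hf : AEMeasurable f) {p : ℝ} (hp : 1 ≤ p) :
    ∫⁻ t, (∫⁻ s, f s * κ (t - s)) ^ p ≤ (∫⁻ r, κ r) ^ p * ∫⁻ s, f s ^ p := by
  have hp0 : 0 < p := by linarith
  have hm : AEMeasurable (Function.uncurry fun t s : ℝ => f s ^ p * κ (t - s))
      (volume.prod volume) := by
    refine AEMeasurable.mul ?_ ?_
    · exact (hf.pow_const p).comp_snd
    · exact (hκ.comp (measurable_fst.sub measurable_snd)).aemeasurable
  calc ∫⁻ t, (∫⁻ s, f s * κ (t - s)) ^ p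
      ≤ ∫⁻ t, (∫⁻ r, κ r) ^ (p - 1) * ∫⁻ s, f s ^ p * κ (t - s) := by
        refine lintegral_mono fun t => ?_
        refine (lintegral_mul_rpow_le hf
          (hκ.comp (measurable_const.sub measurable_id)).aemeasurable hp).trans_eq ?_
        simp only [Function.comp, Pi.sub_apply, id]
        rw [lintegral_sub_left_eq_self κ t]
    _ = (∫⁻ r, κ r) ^ (p - 1) * ∫⁻ s, ∫⁻ t, f s ^ p * κ (t - s) := by
        rw [lintegral_const_mul' _ _ (ENNReal.rpow_ne_top_of_nonneg (by linarith) hκ'),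
          lintegral_lintegral_swap hm]
    _ = (∫⁻ r, κ r) ^ (p - 1) * ∫⁻ s, (∫⁻ r, κ r) * f s ^ p := by
        congr 1
        refine lintegral_congr fun s => ?_
        rw [lintegral_const_mul _ (by fun_prop),
          lintegral_sub_right_eq_self κ s, mul_comm]
    _ = _ := by
        rw [lintegral_const_mul' _ _ hκ', ← mul_assoc]
        congr 1
        nth_rw 2 [← ENNReal.rpow_one (∫⁻ r, κ r)]
        rw [← ENNReal.rpow_add_of_nonneg _ _ (by linarith) zero_le_one]
        simp

/-- The kernel `r ^ (a - 1)` of the fractional integral of order `a`, cut off to `(0,T)`, so that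
on `(0,T)` the fractional integral is a convolution over the whole line with an integrable
kernel. -/
noncomputable def rlKernel (T a : ℝ) : ℝ → ℝ :=
  (Ioo 0 T).indicator fun r => r ^ (a - 1)

theorem measurable_rlKernel (T a : ℝ) : Measurable (rlKernel T a) :=
  Measurable.indicator (by fun_prop) measurableSet_Ioo

theorem integrable_rlKernel (T : ℝ) {a : ℝ} (ha : 0 < a) : Integrable (rlKernel T a) := by
  rw [rlKernel, integrable_indicator_iff measurableSet_Ioo]
  rcases le_or_gt T 0 with h | h
  · simp [Ioo_eq_empty (not_lt.2 h)]
  · have := intervalIntegral.intervalIntegrable_rpow' (a := 0) (b := T) (r := a - 1) (by linarith)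
    exact ((intervalIntegrable_iff_integrableOn_Ioc_of_le h.le).1 this).mono_set Ioo_subset_Ioc_self

theorem lintegral_Ioi_rpow {q c : ℝ} (hq : 0 < q) (hc : 0 < c) :
    ∫⁻ t in Ioi c, ENNReal.ofReal (t ^ (-1 - q)) = ENNReal.ofReal (c ^ (-q) / q) := by
  have h := integral_Ioi_rpow_of_lt (a := -1 - q) (by linarith) hc
  rw [← ofReal_integral_eq_lintegral_ofReal (integrableOn_Ioi_rpow_of_lt (by linarith) hc), h]
  · congr 1
    rw [show -1 - q + 1 = -q by ring, neg_div_neg_eq]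
  · filter_upwards [ae_restrict_mem measurableSet_Ioi] with t ht
    have : 0 < t := hc.trans ht
    positivity

/-! ### A fractional Hardy inequality -/

theorem ofReal_abs_rpow_div (x y : ℝ) {p c : ℝ} (hp : 0 ≤ p) :
    ENNReal.ofReal (|x| ^ p / |y| ^ c) = ‖x‖ₑ ^ p * ENNReal.ofReal (|y| ^ (-c)) := by
  rw [div_eq_mul_inv, ← Real.rpow_neg (abs_nonneg _), ENNReal.ofReal_mul (by positivity),
    ← ENNReal.ofReal_rpow_of_nonneg (abs_nonneg _) hp, ← Real.norm_eq_abs x, ofReal_norm]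

/-- Pointwise comparison of `w t` with `w s` for `0 < s < l * t`: such `s` satisfy
`|s - t| ≤ (1 + l) * t`, so the weight `t ^ (-1 - q)` is controlled by the Gagliardo weight. -/
theorem rpow_mul_enorm_rpow_le {p q l : ℝ} (hp : 1 ≤ p) (hq : 0 < q) {w : ℝ → ℝ} {s t : ℝ}
    (hs : 0 < s) (ht : 0 < t) (hl : 0 < l) (hst : s < l * t) :
    ENNReal.ofReal (t ^ (-1 - q)) * ‖w t‖ₑ ^ p ≤
      2 ^ (p - 1) * (ENNReal.ofReal (t ^ (-1 - q)) * ‖w s‖ₑ ^ p +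
        ENNReal.ofReal ((1 + l) ^ (1 + q)) *
          ENNReal.ofReal (|w s - w t| ^ p / |s - t| ^ (1 + q))) := by
  have hp0 : 0 < p := by linarith
  have h1 : ‖w t‖ₑ ^ p ≤ 2 ^ (p - 1) * (‖w s‖ₑ ^ p + ‖w s - w t‖ₑ ^ p) := by
    refine le_trans (ENNReal.rpow_le_rpow ?_ hp0.le) (ENNReal.rpow_add_le_mul_rpow_add_rpow _ _ hp)
    calc ‖w t‖ₑ = ‖w s - (w s - w t)‖ₑ := by congr 1; ring
      _ ≤ _ := enorm_sub_le
  have h2 : ENNReal.ofReal (t ^ (-1 - q)) * ‖w s - w t‖ₑ ^ p ≤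
      ENNReal.ofReal ((1 + l) ^ (1 + q)) *
          ENNReal.ofReal (|w s - w t| ^ p / |s - t| ^ (1 + q)) := by
    rw [ofReal_abs_rpow_div _ _ hp0.le]
    rcases eq_or_ne s t with rfl | hne
    · simp [hp0]
    · have hpos : 0 < |s - t| := abs_pos.2 (sub_ne_zero.2 hne)
      have hle : |s - t| ≤ (1 + l) * t := by
        rw [abs_le]; constructor <;> nlinarith [mul_pos hl ht]
      have : t ^ (-1 - q) ≤ (1 + l) ^ (1 + q) * |s - t| ^ (-(1 + q)) := by
        have h3 : ((1 + l) * t) ^ (-(1 + q)) ≤ |s - t| ^ (-(1 + q)) :=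
          Real.rpow_le_rpow_of_nonpos hpos hle (by linarith)
        calc t ^ (-1 - q) = (1 + l) ^ (1 + q) * ((1 + l) * t) ^ (-(1 + q)) := by
              rw [Real.mul_rpow (by positivity) ht.le, ← mul_assoc, ← Real.rpow_add (by positivity)]
              rw [add_neg_cancel, Real.rpow_zero, one_mul]; congr 1; ring
          _ ≤ _ := by gcongr
      calc _ ≤ ENNReal.ofReal ((1 + l) ^ (1 + q) * |s - t| ^ (-(1 + q))) * ‖w s - w t‖ₑ ^ p := by
            gcongr
        _ = _ := by rw [ENNReal.ofReal_mul (by positivity)]; ring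
  calc _ ≤ ENNReal.ofReal (t ^ (-1 - q)) * (2 ^ (p - 1) * (‖w s‖ₑ ^ p + ‖w s - w t‖ₑ ^ p)) := by
        gcongr
    _ = 2 ^ (p - 1) * (ENNReal.ofReal (t ^ (-1 - q)) * ‖w s‖ₑ ^ p +
          ENNReal.ofReal (t ^ (-1 - q)) * ‖w s - w t‖ₑ ^ p) := by ring
    _ ≤ _ := by gcongr

/-- Averaging `‖w s‖ ^ p` over `0 < s < l * t` reproduces the weighted integral of `‖w‖ ^ p`, with a
factor `l ^ q / q` that comes from `∫_{s / l}^∞ t ^ (-1 - q) dt`. -/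
theorem setLIntegral_dilate_le {p q l T : ℝ} (hq : 0 < q) (hl : 0 < l) {w : ℝ → ℝ}
    (hw : AEMeasurable w (volume.restrict (Ioo 0 T))) :
    ∫⁻ t in Ioo 0 T, ∫⁻ s in Ioo 0 T,
      (if s < l * t then ENNReal.ofReal (t ^ (-1 - q)) else 0) * ‖w s‖ₑ ^ p ≤
    ENNReal.ofReal (l ^ q / q) *
      ∫⁻ t in Ioo 0 T, ENNReal.ofReal (t ^ (-q)) * ‖w t‖ₑ ^ p := by
  have hk : Measurable (Function.uncurry fun t s : ℝ =>
      if s < l * t then ENNReal.ofReal (t ^ (-1 - q)) else 0) := by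
    refine Measurable.ite (measurableSet_lt (by fun_prop) (by fun_prop)) ?_ measurable_const
    fun_prop
  rw [lintegral_lintegral_swap, ← lintegral_const_mul' _ _ ENNReal.ofReal_ne_top]
  · refine setLIntegral_mono_ae' measurableSet_Ioo (ae_of_all _ fun s hs => ?_)
    rw [lintegral_mul_const _ hk.of_uncurry_right, ← mul_assoc,
      ← ENNReal.ofReal_mul (by have := hs.1; positivity)]
    gcongr
    have hc : 0 < s / l := div_pos hs.1 hl
    calc ∫⁻ t in Ioo 0 T, (if s < l * t then ENNReal.ofReal (t ^ (-1 - q)) else 0)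
        ≤ ∫⁻ t, (Ioi (s / l)).indicator (fun t => ENNReal.ofReal (t ^ (-1 - q))) t := by
          refine (setLIntegral_le_lintegral _ _).trans (lintegral_mono fun t => ?_)
          simp only [indicator, mem_Ioi, div_lt_iff₀' hl]
          exact le_rfl
      _ = ENNReal.ofReal ((s / l) ^ (-q) / q) := by
          rw [lintegral_indicator measurableSet_Ioi, lintegral_Ioi_rpow hq hc]
      _ = _ := by
          rw [Real.div_rpow hs.1.le hl.le, Real.rpow_neg hl.le]
          congr 1
          field_simp
  · exact hk.aemeasurable.mul ((hw.enorm.pow_const p).comp_snd)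

/-- Fractional Hardy inequality. Comparing `w t` with the values of `w` on `(0, l * t)` bounds
the left-hand side `A` by `2 ^ (p - 1) * l ^ (ρ * p - 1) / (ρ * p) * A` plus a multiple of the
right-hand side; since `ρ * p ≠ 1`, a suitable `l` (small if `ρ * p > 1`, large if `ρ * p < 1`)
turns the factor into `1 / 2`, and `A` is absorbed. This is where the a priori finiteness of `A` is
needed: for `ρ * p > 1` it encodes that `w` vanishes at `0`, without which the inequality fails for
constants. -/
theorem exists_hardy_le {p ρ T : ℝ} (hp : 1 ≤ p) (hρ : 0 < ρ) (hρp : ρ * p ≠ 1) (hT : 0 < T) :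
    ∃ C : ℝ≥0∞, C ≠ ⊤ ∧ ∀ w : ℝ → ℝ, AEMeasurable w (volume.restrict (Ioo 0 T)) →
      ∫⁻ t in Ioo 0 T, ENNReal.ofReal (t ^ (-(ρ * p))) * ‖w t‖ₑ ^ p ≠ ⊤ →
      ∫⁻ t in Ioo 0 T, ENNReal.ofReal (t ^ (-(ρ * p))) * ‖w t‖ₑ ^ p ≤
        C * ((∫⁻ t in Ioo 0 T, ‖w t‖ₑ ^ p) + gagliardo T ρ p w) := by
  have hp0 : 0 < p := by linarith
  have hq : 0 < ρ * p := mul_pos hρ hp0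
  unfold gagliardo
  generalize ρ * p = q at *
  have hq1 : q - 1 ≠ 0 := sub_ne_zero.2 hρp
  -- The choice of `l` makes the coefficient of the absorbed term exactly `1 / 2`.
  obtain ⟨l, hl, hlq⟩ : ∃ l : ℝ, 0 < l ∧ l ^ (q - 1) = q * 2 ^ (-p) :=
    ⟨(q * 2 ^ (-p)) ^ (1 / (q - 1)), by positivity, by
      rw [← Real.rpow_mul (by positivity), one_div_mul_cancel hq1, Real.rpow_one]⟩
  set c₁ : ℝ≥0∞ := ENNReal.ofReal l⁻¹ * 2 ^ (p - 1) with hc₁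
  set c₂ : ℝ≥0∞ := ENNReal.ofReal ((1 + l) ^ (1 + q)) with hc₂
  set c₃ : ℝ≥0∞ := ENNReal.ofReal ((T / l) ^ (-q)) with hc₃
  have hc₁t : c₁ ≠ ⊤ := ENNReal.mul_ne_top ENNReal.ofReal_ne_top
    (ENNReal.rpow_ne_top_of_nonneg (by linarith) (by simp))
  have hhalf : c₁ * ENNReal.ofReal (l ^ q / q) = ENNReal.ofReal (1 / 2) := by
    have h2 : (2 : ℝ≥0∞) ^ (p - 1) = ENNReal.ofReal (2 ^ (p - 1)) := by
      rw [← ENNReal.ofReal_rpow_of_pos (by norm_num)]; norm_num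
    rw [hc₁, h2, ← ENNReal.ofReal_mul (by positivity), ← ENNReal.ofReal_mul (by positivity)]
    congr 1
    have e1 : l ^ q = l * (q * 2 ^ (-p)) := by
      rw [← hlq, ← Real.rpow_one_add' hl.le (by linarith)]; congr 1; ring
    have e2 : (2 : ℝ) ^ (-p) = (2 ^ (p - 1))⁻¹ / 2 := by
      rw [← Real.rpow_neg (by norm_num), eq_div_iff (by norm_num)]
      nth_rw 2 [← Real.rpow_one 2]
      rw [← Real.rpow_add (by norm_num)]
      congr 1; ring
    rw [e1, e2]
    have : (2 : ℝ) ^ (p - 1) ≠ 0 := by positivity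
    field_simp
  refine ⟨2 * (c₁ * c₂ + c₃), by finiteness, fun w hw hA => ?_⟩
  set A := ∫⁻ t in Ioo 0 T, ENNReal.ofReal (t ^ (-q)) * ‖w t‖ₑ ^ p with hAdef
  set N := ∫⁻ t in Ioo 0 T, ‖w t‖ₑ ^ p with hN
  set S := ∫⁻ s in Ioo 0 T, ∫⁻ t in Ioo 0 T,
    ENNReal.ofReal (|w t - w s| ^ p / |t - s| ^ (1 + q)) with hS
  have hk : Measurable (Function.uncurry fun t s : ℝ =>
      if s < l * t then ENNReal.ofReal (t ^ (-1 - q)) else 0) := by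
    refine Measurable.ite (measurableSet_lt (by fun_prop) (by fun_prop)) ?_ measurable_const
    fun_prop
  have hpt : ∀ t ∈ Ioo 0 T, ENNReal.ofReal (t ^ (-q)) * ‖w t‖ₑ ^ p ≤
      c₁ * ((∫⁻ s in Ioo 0 T,
          (if s < l * t then ENNReal.ofReal (t ^ (-1 - q)) else 0) * ‖w s‖ₑ ^ p) +
        c₂ * ∫⁻ s in Ioo 0 T, ENNReal.ofReal (|w s - w t| ^ p / |s - t| ^ (1 + q)))
        + c₃ * ‖w t‖ₑ ^ p := by
    intro t ht
    have ht0 : 0 < t := ht.1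
    rcases le_or_gt T (l * t) with hlt | hlt
    · refine le_add_of_nonneg_of_le zero_le ?_
      gcongr
      refine ENNReal.ofReal_le_ofReal
        (Real.rpow_le_rpow_of_nonpos (by positivity) ?_ (by linarith))
      rwa [div_le_iff₀' hl]
    · refine le_add_of_le_of_nonneg ?_ zero_le
      have e : ENNReal.ofReal (t ^ (-q)) * ‖w t‖ₑ ^ p = ENNReal.ofReal l⁻¹ *
          ∫⁻ s in Ioo 0 (l * t), ENNReal.ofReal (t ^ (-1 - q)) * ‖w t‖ₑ ^ p := by
        rw [setLIntegral_const, Real.volume_Ioo, sub_zero]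
        calc _ = ENNReal.ofReal (l⁻¹ * t ^ (-1 - q) * (l * t)) * ‖w t‖ₑ ^ p := by
              rw [show -q = (-1 - q) + 1 by ring, Real.rpow_add_one ht0.ne']
              congr 2
              field_simp
          _ = _ := by
              rw [ENNReal.ofReal_mul (by positivity), ENNReal.ofReal_mul (by positivity)]
              ring
      rw [e, hc₁, mul_assoc]
      gcongr
      have hsub : Ioo 0 (l * t) ⊆ Ioo 0 T := Ioo_subset_Ioo_right hlt.le
      calc _ ≤ ∫⁻ s in Ioo 0 (l * t), 2 ^ (p - 1) *
            ((if s < l * t then ENNReal.ofReal (t ^ (-1 - q)) else 0) * ‖w s‖ₑ ^ p +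
            c₂ * ENNReal.ofReal (|w s - w t| ^ p / |s - t| ^ (1 + q))) := by
            refine setLIntegral_mono_ae' measurableSet_Ioo (ae_of_all _ fun s hs => ?_)
            rw [if_pos hs.2]
            exact rpow_mul_enorm_rpow_le hp hq hs.1 ht0 hl hs.2
        _ ≤ ∫⁻ s in Ioo 0 T, 2 ^ (p - 1) *
            ((if s < l * t then ENNReal.ofReal (t ^ (-1 - q)) else 0) * ‖w s‖ₑ ^ p +
            c₂ * ENNReal.ofReal (|w s - w t| ^ p / |s - t| ^ (1 + q))) := lintegral_mono_set hsub
        _ = _ := by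
            rw [lintegral_const_mul' _ _ (ENNReal.rpow_ne_top_of_nonneg (by linarith) (by simp)),
              lintegral_add_left', lintegral_const_mul' _ _ ENNReal.ofReal_ne_top]
            exact (hk.comp (measurable_const.prodMk measurable_id)).aemeasurable.mul
              (hw.enorm.pow_const p)
  have hle : A ≤ ENNReal.ofReal (1 / 2) * A + (c₁ * c₂ + c₃) * (N + S) := by
    calc A ≤ ∫⁻ t in Ioo 0 T, (c₁ * ((∫⁻ s in Ioo 0 T,
          (if s < l * t then ENNReal.ofReal (t ^ (-1 - q)) else 0) * ‖w s‖ₑ ^ p) +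
        c₂ * ∫⁻ s in Ioo 0 T, ENNReal.ofReal (|w s - w t| ^ p / |s - t| ^ (1 + q)))
        + c₃ * ‖w t‖ₑ ^ p) :=
          setLIntegral_mono_ae' measurableSet_Ioo (ae_of_all _ hpt)
      _ = c₁ * ((∫⁻ t in Ioo 0 T, ∫⁻ s in Ioo 0 T,
          (if s < l * t then ENNReal.ofReal (t ^ (-1 - q)) else 0) * ‖w s‖ₑ ^ p) + c₂ * S)
          + c₃ * N := by
          rw [lintegral_add_right', lintegral_const_mul' _ _ hc₁t, lintegral_add_left',
            lintegral_const_mul' _ _ ENNReal.ofReal_ne_top,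
            lintegral_const_mul' _ _ ENNReal.ofReal_ne_top]
          · exact AEMeasurable.lintegral_prod_right'
              (hk.aemeasurable.mul ((hw.enorm.pow_const p).comp_snd))
          · exact (hw.enorm.pow_const p).const_mul _
      _ ≤ c₁ * (ENNReal.ofReal (l ^ q / q) * A + c₂ * S) + c₃ * N := by
          gcongr
          exact setLIntegral_dilate_le hq hl hw
      _ = ENNReal.ofReal (1 / 2) * A + (c₁ * c₂ * S + c₃ * N) := by
          rw [mul_add, ← mul_assoc, hhalf]; ring
      _ ≤ ENNReal.ofReal (1 / 2) * A + ((c₁ * c₂ + c₃) * S + (c₁ * c₂ + c₃) * N) := by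
          gcongr
          · exact le_self_add
          · exact le_add_self
      _ = _ := by ring
  set B := (c₁ * c₂ + c₃) * (N + S)
  rw [mul_assoc]
  change A ≤ 2 * B
  rcases eq_or_ne B ⊤ with hB | hB
  · simp [hB]
  · rw [← ENNReal.toReal_le_toReal hA (by finiteness)]
    have h := ENNReal.toReal_mono (by finiteness) hle
    rw [ENNReal.toReal_add (by finiteness) hB, ENNReal.toReal_mul,
      ENNReal.toReal_ofReal (by norm_num)] at h
    rw [ENNReal.toReal_mul]
    simp only [ENNReal.toReal_ofNat]
    linarith

/-! ### The singular integral of the difference quotient -/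

/-- With `ε = τ - σ`, the kernel `(t - s) ^ (-1 - σ)` is `(t - s) ^ (-τ)` times the integrable
kernel `(t - s) ^ (ε - 1)`, to which Jensen's inequality applies; the excess factor `(t - s) ^ ε`
is at most `T ^ ε`. -/
theorem exists_singular_le {p σ τ T : ℝ} (hp : 1 ≤ p) (hστ : σ < τ) :
    ∃ C : ℝ≥0∞, C ≠ ⊤ ∧ ∀ w : ℝ → ℝ, AEMeasurable w (volume.restrict (Ioo 0 T)) →
      ∫⁻ t in Ioo 0 T,
        (∫⁻ s in Ioo 0 t, ‖w t - w s‖ₑ * ENNReal.ofReal ((t - s) ^ (-1 - σ))) ^ p ≤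
        C * gagliardo T τ p w := by
  have hp0 : 0 < p := by linarith
  have hε : 0 < τ - σ := sub_pos.2 hστ
  have hK : ∫⁻ r, ‖rlKernel T (τ - σ) r‖ₑ ≠ ⊤ := (integrable_rlKernel T hε).2.ne
  have hKp : (∫⁻ r, ‖rlKernel T (τ - σ) r‖ₑ) ^ (p - 1) ≠ ⊤ :=
    ENNReal.rpow_ne_top_of_nonneg (by linarith) hK
  refine ⟨(∫⁻ r, ‖rlKernel T (τ - σ) r‖ₑ) ^ (p - 1) * ENNReal.ofReal (T ^ (τ - σ)),
    by finiteness, fun w hw => ?_⟩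
  unfold gagliardo
  rw [← lintegral_const_mul' _ _ (by finiteness)]
  refine setLIntegral_mono_ae' measurableSet_Ioo (ae_of_all _ fun t ht => ?_)
  have hwt : AEMeasurable w (volume.restrict (Ioo 0 t)) :=
    hw.mono_measure (Measure.restrict_mono_set _ (Ioo_subset_Ioo_right ht.2.le))
  have hT0 : 0 < T := ht.1.trans ht.2
  have hker : ∀ s ∈ Ioo 0 t, ‖rlKernel T (τ - σ) (t - s)‖ₑ =
      ENNReal.ofReal ((t - s) ^ (τ - σ - 1)) := by
    intro s hs
    have h1 : 0 < t - s := sub_pos.2 hs.2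
    rw [rlKernel, indicator_of_mem (show t - s ∈ Ioo 0 T from ⟨h1, by linarith [hs.1, ht.2]⟩),
      Real.enorm_of_nonneg (by positivity)]
  have e : ∫⁻ s in Ioo 0 t, ‖w t - w s‖ₑ * ENNReal.ofReal ((t - s) ^ (-1 - σ)) =
      ∫⁻ s in Ioo 0 t, (‖w t - w s‖ₑ * ENNReal.ofReal ((t - s) ^ (-τ))) *
        ‖rlKernel T (τ - σ) (t - s)‖ₑ := by
    refine setLIntegral_congr_fun measurableSet_Ioo fun s hs => ?_
    have h1 : 0 < t - s := sub_pos.2 hs.2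
    simp only [hker s hs]
    rw [mul_assoc, ← ENNReal.ofReal_mul (by positivity), ← Real.rpow_add h1]
    congr 3; ring
  have hkm : Measurable fun s => ‖rlKernel T (τ - σ) (t - s)‖ₑ :=
    ((measurable_rlKernel T (τ - σ)).comp (measurable_const.sub measurable_id)).enorm
  rw [e]
  refine (lintegral_mul_rpow_le (by fun_prop) hkm.aemeasurable hp).trans ?_
  rw [mul_assoc]
  refine mul_le_mul' (ENNReal.rpow_le_rpow ?_ (by linarith)) ?_
  · refine (setLIntegral_le_lintegral _ _).trans_eq ?_
    exact lintegral_sub_left_eq_self (fun r => ‖rlKernel T (τ - σ) r‖ₑ) t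
  · rw [← lintegral_const_mul' _ _ ENNReal.ofReal_ne_top]
    refine le_trans ?_ (lintegral_mono_set (Ioo_subset_Ioo_right ht.2.le))
    refine setLIntegral_mono_ae' measurableSet_Ioo (ae_of_all _ fun s hs => ?_)
    have h1 : 0 < t - s := sub_pos.2 hs.2
    rw [hker s hs, ofReal_abs_rpow_div _ _ hp0.le, ENNReal.mul_rpow_of_nonneg _ _ hp0.le,
      ENNReal.ofReal_rpow_of_nonneg (by positivity) hp0.le, mul_assoc,
      ← ENNReal.ofReal_mul (by positivity), mul_left_comm, ← ENNReal.ofReal_mul (by positivity),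
      enorm_sub_rev, abs_sub_comm, abs_of_pos h1]
    refine mul_le_mul' le_rfl (ENNReal.ofReal_le_ofReal ?_)
    have h2 : (t - s) ^ (τ - σ) ≤ T ^ (τ - σ) :=
      Real.rpow_le_rpow h1.le (by linarith [hs.1, ht.2]) hε.le
    calc ((t - s) ^ (-τ)) ^ p * (t - s) ^ (τ - σ - 1)
        = (t - s) ^ (τ - σ) * (t - s) ^ (-(1 + τ * p)) := by
          rw [← Real.rpow_mul h1.le, ← Real.rpow_add h1, ← Real.rpow_add h1]; congr 1; ring
      _ ≤ _ := by gcongr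

/-! ### The fractional integral as a convolution -/

theorem fracInt_eq_integral {T a t : ℝ} (ht : t ∈ Ioo 0 T) (u : ℝ → ℝ) :
    fracInt a u t =
      1 / Real.Gamma a * ∫ s, (Ioo 0 T).indicator u s * rlKernel T a (t - s) := by
  rw [fracInt, intervalIntegral.integral_of_le ht.1.le, integral_Ioc_eq_integral_Ioo,
    ← integral_indicator measurableSet_Ioo]
  congr 2
  ext s
  by_cases hs : s ∈ Ioo 0 t
  · rw [indicator_of_mem hs, indicator_of_mem (show s ∈ Ioo 0 T from ⟨hs.1, hs.2.trans ht.2⟩),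
      rlKernel, indicator_of_mem
        (show t - s ∈ Ioo 0 T from ⟨sub_pos.2 hs.2, by linarith [hs.1, ht.2]⟩),
      mul_comm]
  · rw [indicator_of_notMem hs]
    by_cases hs' : s ∈ Ioo 0 T
    · have : t - s ∉ Ioo 0 T := fun h => hs ⟨hs'.1, sub_pos.1 h.1⟩
      simp [rlKernel, this]
    · simp [hs']

theorem integrable_fracInt_integrand {T a : ℝ} (ha : 0 < a) {u : ℝ → ℝ}
    (hu : IntegrableOn u (Ioo 0 T)) :
    Integrable (fun z : ℝ × ℝ => (Ioo 0 T).indicator u z.2 * rlKernel T a (z.1 - z.2))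
      (volume.prod volume) :=
  Integrable.convolution_integrand (ContinuousLinearMap.mul ℝ ℝ)
    ((integrable_indicator_iff measurableSet_Ioo).2 hu) (integrable_rlKernel T ha)

theorem integrableOn_fracInt {T a : ℝ} (ha : 0 < a) {u : ℝ → ℝ}
    (hu : IntegrableOn u (Ioo 0 T)) : IntegrableOn (fracInt a u) (Ioo 0 T) := by
  have h := (((integrable_fracInt_integrand ha hu).integral_prod_left).const_mul
    (1 / Real.Gamma a)).integrableOn (s := Ioo 0 T)
  exact h.congr_fun (fun t ht => (fracInt_eq_integral ht u).symm) measurableSet_Ioo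

/-- The equality holds only almost everywhere: for `u`, `v` in `L¹` the defining integrals may
diverge on a null set. -/
theorem fracInt_sub_ae {T a : ℝ} (ha : 0 < a) {u v : ℝ → ℝ}
    (hu : IntegrableOn u (Ioo 0 T)) (hv : IntegrableOn v (Ioo 0 T)) :
    fracInt a (u - v) =ᵐ[volume.restrict (Ioo 0 T)] fracInt a u - fracInt a v := by
  filter_upwards [ae_restrict_mem measurableSet_Ioo,
    ae_restrict_of_ae (integrable_fracInt_integrand ha hu).prod_right_ae,
    ae_restrict_of_ae (integrable_fracInt_integrand ha hv).prod_right_ae] with t ht h1 h2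
  simp only [Pi.sub_apply, fracInt_eq_integral ht, indicator_sub', sub_mul]
  rw [integral_sub h1 h2, mul_sub]

theorem fracInt_congr_ae {T a : ℝ} {u v : ℝ → ℝ}
    (h : u =ᵐ[volume.restrict (Ioo 0 T)] v) {t : ℝ} (ht : t ∈ Ioo 0 T) :
    fracInt a u t = fracInt a v t := by
  rw [fracInt_eq_integral ht, fracInt_eq_integral ht]
  congr 1
  refine integral_congr_ae ?_
  filter_upwards [(ae_restrict_iff' measurableSet_Ioo).1 h] with s hs
  by_cases hs' : s ∈ Ioo 0 T
  · simp [hs', hs hs']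
  · simp [hs']

theorem exists_eLpNorm_fracInt_le {p a : ℝ} (T : ℝ) (hp : 1 ≤ p) (ha : 0 < a) :
    ∃ C : ℝ≥0∞, C ≠ ⊤ ∧ ∀ u : ℝ → ℝ, AEMeasurable u (volume.restrict (Ioo 0 T)) →
      eLpNorm (fracInt a u) (ENNReal.ofReal p) (volume.restrict (Ioo 0 T)) ≤
        C * eLpNorm u (ENNReal.ofReal p) (volume.restrict (Ioo 0 T)) := by
  have hp0 : 0 < p := by linarith
  have hK : ∫⁻ r, ‖rlKernel T a r‖ₑ ≠ ⊤ := (integrable_rlKernel T ha).2.ne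
  refine ⟨‖1 / Real.Gamma a‖ₑ * ∫⁻ r, ‖rlKernel T a r‖ₑ, by finiteness, fun u hu => ?_⟩
  rw [← ENNReal.rpow_le_rpow_iff hp0, ENNReal.mul_rpow_of_nonneg _ _ hp0.le,
    eLpNorm_rpow_eq_lintegral hp, eLpNorm_rpow_eq_lintegral hp,
    ENNReal.mul_rpow_of_nonneg _ _ hp0.le, mul_assoc]
  have hf : AEMeasurable fun s => ‖(Ioo 0 T).indicator u s‖ₑ :=
    ((aemeasurable_indicator_iff measurableSet_Ioo).2 hu).enorm
  calc ∫⁻ t in Ioo 0 T, ‖fracInt a u t‖ₑ ^ p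
      ≤ ∫⁻ t in Ioo 0 T, ‖1 / Real.Gamma a‖ₑ ^ p *
          (∫⁻ s, ‖(Ioo 0 T).indicator u s‖ₑ * ‖rlKernel T a (t - s)‖ₑ) ^ p := by
        refine setLIntegral_mono_ae' measurableSet_Ioo (ae_of_all _ fun t ht => ?_)
        rw [fracInt_eq_integral ht, enorm_mul, ENNReal.mul_rpow_of_nonneg _ _ hp0.le]
        gcongr
        refine (enorm_integral_le_lintegral_enorm _).trans_eq ?_
        simp only [enorm_mul]
    _ ≤ ‖1 / Real.Gamma a‖ₑ ^ p *
          ∫⁻ t, (∫⁻ s, ‖(Ioo 0 T).indicator u s‖ₑ * ‖rlKernel T a (t - s)‖ₑ) ^ p := by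
        rw [lintegral_const_mul' _ _ (ENNReal.rpow_ne_top_of_nonneg hp0.le (by finiteness))]
        gcongr
        exact Measure.restrict_le_self
    _ ≤ ‖1 / Real.Gamma a‖ₑ ^ p * ((∫⁻ r, ‖rlKernel T a r‖ₑ) ^ p *
          ∫⁻ s, ‖(Ioo 0 T).indicator u s‖ₑ ^ p) := by
        gcongr
        exact lintegral_convolution_rpow_le (κ := fun r => ‖rlKernel T a r‖ₑ)
          (measurable_rlKernel T a).enorm hK hf hp
    _ = _ := by
        rw [← lintegral_indicator measurableSet_Ioo]
        congr 3
        ext s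
        by_cases hs : s ∈ Ioo 0 T
        · simp [hs]
        · simp [hs, hp0]

/-! ### Weak derivatives -/

theorem integrableOn_of_memLp {p T : ℝ} (hp : 1 ≤ p) {u : ℝ → ℝ}
    (hu : MemLp u (ENNReal.ofReal p) (volume.restrict (Ioo 0 T))) : IntegrableOn u (Ioo 0 T) :=
  MemLp.integrable (by simpa using hp) hu

theorem continuous_iteratedDeriv_of_smooth {φ : ℝ → ℝ} (hφ : ContDiff ℝ ∞ φ) (k : ℕ) :
    Continuous (iteratedDeriv k φ) :=
  hφ.continuous_iteratedDeriv k (by exact_mod_cast le_top)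

theorem tsupport_iteratedDeriv_subset (φ : ℝ → ℝ) (k : ℕ) :
    tsupport (iteratedDeriv k φ) ⊆ tsupport φ := by
  induction k with
  | zero => simp
  | succ k ih =>
    rw [iteratedDeriv_succ]
    exact subset_trans tsupport_deriv_subset ih

theorem hasCompactSupport_iteratedDeriv {φ : ℝ → ℝ} (h : HasCompactSupport φ) (k : ℕ) :
    HasCompactSupport (iteratedDeriv k φ) :=
  h.of_isClosed_subset (isClosed_tsupport _) (tsupport_iteratedDeriv_subset φ k)

theorem integrableOn_mul_test {T : ℝ} {u χ : ℝ → ℝ} (hu : LocallyIntegrableOn u (Ioo 0 T))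
    (hχ : Continuous χ) (hc : HasCompactSupport χ) (hs : tsupport χ ⊆ Ioo 0 T) :
    IntegrableOn (fun t => u t * χ t) (Ioo 0 T) := by
  have h1 : IntegrableOn (fun t => u t * χ t) (tsupport χ) :=
    (hu.integrableOn_compact_subset hs hc).mul_continuousOn hχ.continuousOn hc
  have h2 : Integrable (fun t => u t * χ t) := by
    rw [← integrableOn_iff_integrable_of_support_subset (s := tsupport χ)]
    · exact h1
    · exact (Function.support_mul_subset_right _ _).trans (subset_tsupport χ)
  exact h2.integrableOn

theorem HasWeakDeriv.sub {T : ℝ} {k : ℕ} {u v g h : ℝ → ℝ} (hu : HasWeakDeriv T k u g)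
    (hv : HasWeakDeriv T k v h) : HasWeakDeriv T k (u - v) (g - h) := by
  refine ⟨hu.1.sub hv.1, hu.2.1.sub hv.2.1, fun φ hφ hc hs => ?_⟩
  have hk := continuous_iteratedDeriv_of_smooth hφ k
  have hck := hasCompactSupport_iteratedDeriv hc k
  have hsk := (tsupport_iteratedDeriv_subset φ k).trans hs
  simp only [Pi.sub_apply, sub_mul]
  rw [integral_sub (integrableOn_mul_test hu.1 hk hck hsk)
      (integrableOn_mul_test hv.1 hk hck hsk),
    integral_sub (integrableOn_mul_test hu.2.1 hφ.continuous hc hs)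
      (integrableOn_mul_test hv.2.1 hφ.continuous hc hs),
    hu.2.2 φ hφ hc hs, hv.2.2 φ hφ hc hs, mul_sub]

theorem hasWeakDeriv_zero {T : ℝ} {u : ℝ → ℝ} (hu : LocallyIntegrableOn u (Ioo 0 T)) :
    HasWeakDeriv T 0 u u :=
  ⟨hu, hu, fun φ _ _ _ => by simp⟩

theorem HasWeakDeriv.ae_eq {T : ℝ} {k : ℕ} {u g h : ℝ → ℝ} (hg : HasWeakDeriv T k u g)
    (hh : HasWeakDeriv T k u h) : g =ᵐ[volume.restrict (Ioo 0 T)] h := by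
  have key := isOpen_Ioo.ae_eq_zero_of_integral_contDiff_smul_eq_zero (f := g - h) (μ := volume)
    (U := Ioo 0 T) (hg.2.1.sub hh.2.1) (fun φ hφ hc hs => by
      have e : ∫ x, φ x • (g - h) x = ∫ x in Ioo 0 T, (g x * φ x - h x * φ x) := by
        rw [setIntegral_eq_integral_of_forall_compl_eq_zero]
        · refine integral_congr_ae (ae_of_all _ fun x => ?_)
          simp only [Pi.sub_apply, smul_eq_mul]; ring
        · intro x hx
          have : φ x = 0 := image_eq_zero_of_notMem_tsupport fun h => hx (hs h)
          simp [this]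
      rw [e, integral_sub (integrableOn_mul_test hg.2.1 hφ.continuous hc hs)
        (integrableOn_mul_test hh.2.1 hφ.continuous hc hs), sub_eq_zero]
      have h1 := hg.2.2 φ hφ hc hs
      have h2 := hh.2.2 φ hφ hc hs
      exact mul_left_cancel₀ (pow_ne_zero k (by norm_num : (-1 : ℝ) ≠ 0)) (h1.symm.trans h2))
  rw [EventuallyEq, ae_restrict_iff' measurableSet_Ioo]
  filter_upwards [key] with x hx hxI
  exact sub_eq_zero.1 (hx hxI)

theorem HasWeakDeriv.weakDeriv_ae_eq {T : ℝ} {k : ℕ} {u g : ℝ → ℝ} (hg : HasWeakDeriv T k u g) :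
    weakDeriv T k u =ᵐ[volume.restrict (Ioo 0 T)] g := by
  have h : ∃ g, HasWeakDeriv T k u g := ⟨g, hg⟩
  rw [weakDeriv, dif_pos h]
  exact h.choose_spec.ae_eq hg

theorem MemSobolev.hasWeakDeriv {T p : ℝ} {n k : ℕ} {u : ℝ → ℝ} (hu : MemSobolev T n p u)
    (hk : k ≤ n) : HasWeakDeriv T k u (weakDeriv T k u) := by
  obtain ⟨g, hg, -⟩ := hu k hk
  have h : ∃ g, HasWeakDeriv T k u g := ⟨g, hg⟩
  rw [weakDeriv, dif_pos h]
  exact h.choose_spec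

theorem MemSobolev.memLp {T p : ℝ} {n k : ℕ} {u : ℝ → ℝ} (hu : MemSobolev T n p u)
    (hk : k ≤ n) :
    MemLp (weakDeriv T k u) (ENNReal.ofReal p) (volume.restrict (Ioo 0 T)) := by
  obtain ⟨g, hg, hg'⟩ := hu k hk
  exact hg'.ae_eq hg.weakDeriv_ae_eq.symm

theorem MemSobolev.weakDeriv_zero_ae_eq {T p : ℝ} {n : ℕ} {u : ℝ → ℝ} (hu : MemSobolev T n p u) :
    weakDeriv T 0 u =ᵐ[volume.restrict (Ioo 0 T)] u :=
  (hasWeakDeriv_zero (hu.hasWeakDeriv (Nat.zero_le n)).1).weakDeriv_ae_eq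

theorem MemSobolev.memLp_self {T p : ℝ} {n : ℕ} {u : ℝ → ℝ} (hu : MemSobolev T n p u) :
    MemLp u (ENNReal.ofReal p) (volume.restrict (Ioo 0 T)) :=
  (hu.memLp (Nat.zero_le n)).ae_eq hu.weakDeriv_zero_ae_eq

theorem MemSobolev.weakDeriv_sub_ae_eq {T p : ℝ} {n k : ℕ} {u v : ℝ → ℝ}
    (hu : MemSobolev T n p u) (hv : MemSobolev T n p v) (hk : k ≤ n) :
    weakDeriv T k (u - v) =ᵐ[volume.restrict (Ioo 0 T)] weakDeriv T k u - weakDeriv T k v :=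
  ((hu.hasWeakDeriv hk).sub (hv.hasWeakDeriv hk)).weakDeriv_ae_eq

theorem tendsto_integral_mul_test {p T : ℝ} (hp : 1 ≤ p) {F : ℕ → ℝ → ℝ} {f χ : ℝ → ℝ}
    (hF : ∀ j, MemLp (F j) (ENNReal.ofReal p) (volume.restrict (Ioo 0 T)))
    (hf : MemLp f (ENNReal.ofReal p) (volume.restrict (Ioo 0 T)))
    (h : Tendsto (fun j => eLpNorm (F j - f) (ENNReal.ofReal p) (volume.restrict (Ioo 0 T)))
      atTop (𝓝 0))
    (hχ : Continuous χ) (hc : HasCompactSupport χ) :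
    Tendsto (fun j => ∫ t in Ioo 0 T, F j t * χ t) atTop (𝓝 (∫ t in Ioo 0 T, f t * χ t)) := by
  obtain ⟨B, hB⟩ := hχ.bounded_above_of_compact_support hc
  have hp' : (1 : ℝ≥0∞) ≤ ENNReal.ofReal p := by simpa using hp
  have hint : ∀ g : ℝ → ℝ, MemLp g (ENNReal.ofReal p) (volume.restrict (Ioo 0 T)) →
      Integrable (fun t => g t * χ t) (volume.restrict (Ioo 0 T)) := fun g hg =>
    (integrableOn_of_memLp hp hg).mul_bdd hχ.aestronglyMeasurable (ae_of_all _ hB)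
  refine tendsto_integral_of_L1' _ (hint f hf).1 (Eventually.of_forall fun j => hint _ (hF j)) ?_
  set c : ℝ≥0∞ := ENNReal.ofReal B *
    (volume.restrict (Ioo 0 T) univ ^ (1 / (1 : ℝ≥0∞).toReal - 1 / (ENNReal.ofReal p).toReal))
    with hcdef
  have hct : c ≠ ⊤ := by
    refine ENNReal.mul_ne_top ENNReal.ofReal_ne_top (ENNReal.rpow_ne_top_of_nonneg ?_ (by simp))
    rw [ENNReal.toReal_ofReal (by linarith)]
    simpa using inv_le_one_of_one_le₀ hp
  have hlim : Tendsto (fun j =>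
      c * eLpNorm (F j - f) (ENNReal.ofReal p) (volume.restrict (Ioo 0 T))) atTop (𝓝 0) := by
    simpa using ENNReal.Tendsto.const_mul h (Or.inr hct)
  refine tendsto_of_tendsto_of_tendsto_of_le_of_le tendsto_const_nhds hlim
    (fun _ => zero_le) fun j => ?_
  calc eLpNorm ((fun t => F j t * χ t) - fun t => f t * χ t) 1 (volume.restrict (Ioo 0 T))
      ≤ ENNReal.ofReal B * eLpNorm (F j - f) 1 (volume.restrict (Ioo 0 T)) := by
        refine eLpNorm_le_mul_eLpNorm_of_ae_le_mul (ae_of_all _ fun t => ?_) 1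
        simp only [Pi.sub_apply, ← sub_mul, norm_mul]
        rw [mul_comm]
        gcongr
        exact hB t
    _ ≤ ENNReal.ofReal B *
          (eLpNorm (F j - f) (ENNReal.ofReal p) (volume.restrict (Ioo 0 T)) * _) := by
        gcongr
        exact eLpNorm_le_eLpNorm_mul_rpow_measure_univ hp'
          ((hF j).1.sub hf.1)
    _ = _ := by rw [hcdef]; ring

/-- Weak differentiation is a closed operator in `L^p(0,T)`. -/
theorem hasWeakDeriv_of_tendsto {p T : ℝ} (hp : 1 ≤ p) {k : ℕ} {F G : ℕ → ℝ → ℝ} {f g : ℝ → ℝ}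
    (hF : ∀ j, MemLp (F j) (ENNReal.ofReal p) (volume.restrict (Ioo 0 T)))
    (hf : MemLp f (ENNReal.ofReal p) (volume.restrict (Ioo 0 T)))
    (hG : ∀ j, MemLp (G j) (ENNReal.ofReal p) (volume.restrict (Ioo 0 T)))
    (hg : MemLp g (ENNReal.ofReal p) (volume.restrict (Ioo 0 T)))
    (hFf : Tendsto (fun j => eLpNorm (F j - f) (ENNReal.ofReal p) (volume.restrict (Ioo 0 T)))
      atTop (𝓝 0))
    (hGg : Tendsto (fun j => eLpNorm (G j - g) (ENNReal.ofReal p) (volume.restrict (Ioo 0 T)))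
      atTop (𝓝 0))
    (h : ∀ j, HasWeakDeriv T k (F j) (G j)) : HasWeakDeriv T k f g := by
  refine ⟨(integrableOn_of_memLp hp hf).locallyIntegrableOn,
    (integrableOn_of_memLp hp hg).locallyIntegrableOn, fun φ hφ hc hs => ?_⟩
  have h1 := tendsto_integral_mul_test hp hF hf hFf (continuous_iteratedDeriv_of_smooth hφ k)
    (hasCompactSupport_iteratedDeriv hc k)
  have h2 := (tendsto_integral_mul_test hp hG hg hGg hφ.continuous hc).const_mul ((-1 : ℝ) ^ k)
  refine tendsto_nhds_unique h1 (h2.congr fun j => ?_)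
  exact ((h j).2.2 φ hφ hc hs).symm

/-! ### Slobodeckij norms -/

theorem gagliardo_congr {T τ p : ℝ} {f g : ℝ → ℝ} (h : f =ᵐ[volume.restrict (Ioo 0 T)] g) :
    gagliardo T τ p f = gagliardo T τ p g := by
  refine lintegral_congr_ae ?_
  filter_upwards [h] with s hs
  refine lintegral_congr_ae ?_
  filter_upwards [h] with t ht
  rw [hs, ht]

theorem gagliardo_sub_le {T τ p : ℝ} (hp : 1 ≤ p) {f g : ℝ → ℝ}
    (hf : AEMeasurable f (volume.restrict (Ioo 0 T))) :
    gagliardo T τ p (f - g) ≤ 2 ^ (p - 1) * (gagliardo T τ p f + gagliardo T τ p g) := by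
  have hp0 : 0 < p := by linarith
  have h2 : (2 : ℝ≥0∞) ^ (p - 1) ≠ ⊤ := ENNReal.rpow_ne_top_of_nonneg (by linarith) (by simp)
  have hm : AEMeasurable (fun z : ℝ × ℝ =>
      ENNReal.ofReal (|f z.2 - f z.1| ^ p / |z.2 - z.1| ^ (1 + τ * p)))
      ((volume.restrict (Ioo 0 T)).prod (volume.restrict (Ioo 0 T))) := by
    have h1 : AEMeasurable (fun z : ℝ × ℝ => f z.1)
      ((volume.restrict (Ioo 0 T)).prod (volume.restrict (Ioo 0 T))) := hf.comp_fst
    have h2 : AEMeasurable (fun z : ℝ × ℝ => f z.2)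
      ((volume.restrict (Ioo 0 T)).prod (volume.restrict (Ioo 0 T))) := hf.comp_snd
    fun_prop
  unfold gagliardo
  have hmi := hm.lintegral_prod_right'
  beta_reduce at hmi
  rw [← lintegral_add_left' hmi, ← lintegral_const_mul' _ _ h2]
  refine lintegral_mono fun s => ?_
  have hms : AEMeasurable (fun t : ℝ => ENNReal.ofReal (|f t - f s| ^ p / |t - s| ^ (1 + τ * p)))
      (volume.restrict (Ioo 0 T)) := by fun_prop
  rw [← lintegral_add_left' hms, ← lintegral_const_mul' _ _ h2]
  refine lintegral_mono fun t => ?_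
  simp only [ofReal_abs_rpow_div _ _ hp0.le, Pi.sub_apply, ← add_mul, ← mul_assoc]
  gcongr
  refine le_trans (ENNReal.rpow_le_rpow ?_ hp0.le) (ENNReal.rpow_add_le_mul_rpow_add_rpow _ _ hp)
  rw [show f t - g t - (f s - g s) = (f t - f s) - (g t - g s) by ring]
  exact enorm_sub_le

theorem sobolevNorm_le_slobodeckiNorm {T β p : ℝ} (hp : 1 ≤ p) (u : ℝ → ℝ) :
    sobolevNorm T ⌊β⌋₊ p u ≤ slobodeckiNorm T β p u := by
  have hp0 : 0 < p := by linarith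
  rw [slobodeckiNorm, one_div, ENNReal.le_rpow_inv_iff hp0]
  exact le_self_add

theorem eLpNorm_weakDeriv_le_slobodeckiNorm {T β p : ℝ} (hp : 1 ≤ p) (u : ℝ → ℝ) {k : ℕ}
    (hk : k ≤ ⌊β⌋₊) :
    eLpNorm (weakDeriv T k u) (ENNReal.ofReal p) (volume.restrict (Ioo 0 T)) ≤
      slobodeckiNorm T β p u :=
  (Finset.single_le_sum (f := fun k => eLpNorm (weakDeriv T k u) (ENNReal.ofReal p)
    (volume.restrict (Ioo 0 T))) (fun _ _ => zero_le)
    (Finset.mem_range.2 (Nat.lt_succ_of_le hk))).trans (sobolevNorm_le_slobodeckiNorm hp u)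

theorem gagliardo_le_slobodeckiNorm {T β p : ℝ} (hp : 1 ≤ p) (u : ℝ → ℝ) :
    gagliardo T (Int.fract β) p (weakDeriv T ⌊β⌋₊ u) ≤ slobodeckiNorm T β p u ^ p := by
  have hp0 : 0 < p := by linarith
  rw [slobodeckiNorm, ← ENNReal.rpow_mul, one_div_mul_cancel hp0.ne', ENNReal.rpow_one]
  exact le_add_self

/-- A triangle inequality with a constant, which is all that the passage to the closure needs. -/
theorem slobodeckiNorm_sub_le {T β p : ℝ} (hp : 1 ≤ p) {u v : ℝ → ℝ}
    (hu : MemSobolev T ⌊β⌋₊ p u) (hv : MemSobolev T ⌊β⌋₊ p v) :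
    slobodeckiNorm T β p (u - v) ≤ 3 * (slobodeckiNorm T β p u + slobodeckiNorm T β p v) := by
  have hp0 : 0 < p := by linarith
  set X := slobodeckiNorm T β p u with hX
  set Y := slobodeckiNorm T β p v with hY
  have h1 : sobolevNorm T ⌊β⌋₊ p (u - v) ≤ X + Y := by
    calc sobolevNorm T ⌊β⌋₊ p (u - v) ≤ sobolevNorm T ⌊β⌋₊ p u + sobolevNorm T ⌊β⌋₊ p v := by
          unfold sobolevNorm
          rw [← Finset.sum_add_distrib]
          refine Finset.sum_le_sum fun k hk => ?_
          have hk' : k ≤ ⌊β⌋₊ := Nat.lt_succ_iff.1 (Finset.mem_range.1 hk)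
          rw [eLpNorm_congr_ae (hu.weakDeriv_sub_ae_eq hv hk')]
          exact eLpNorm_sub_le (hu.memLp hk').1 (hv.memLp hk').1 (by simpa using hp)
      _ ≤ X + Y := add_le_add (sobolevNorm_le_slobodeckiNorm hp u)
          (sobolevNorm_le_slobodeckiNorm hp v)
  have h2 : gagliardo T (Int.fract β) p (weakDeriv T ⌊β⌋₊ (u - v)) ≤ (2 * (X + Y)) ^ p := by
    rw [gagliardo_congr (hu.weakDeriv_sub_ae_eq hv le_rfl)]
    refine (gagliardo_sub_le hp (hu.memLp le_rfl).1.aemeasurable).trans ?_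
    rw [ENNReal.mul_rpow_of_nonneg _ _ hp0.le]
    gcongr
    · norm_num
    · linarith
    · exact (add_le_add (gagliardo_le_slobodeckiNorm hp u)
        (gagliardo_le_slobodeckiNorm hp v)).trans (ENNReal.add_rpow_le_rpow_add _ _ hp)
  calc slobodeckiNorm T β p (u - v) ≤ ((X + Y) ^ p + (2 * (X + Y)) ^ p) ^ (1 / p) := by
        rw [slobodeckiNorm]
        gcongr
    _ ≤ ((X + Y + 2 * (X + Y)) ^ p) ^ (1 / p) := by
        gcongr
        exact ENNReal.add_rpow_le_rpow_add _ _ hp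
    _ = 3 * (X + Y) := by
        rw [← ENNReal.rpow_mul, mul_one_div_cancel hp0.ne', ENNReal.rpow_one]; ring

/-! ### The derivative of the fractional integral of a function vanishing at the origin -/

theorem sub_eq_integral_deriv {T : ℝ} {w w' : ℝ → ℝ} (hw : ContinuousOn w (Icc 0 T))
    (hw' : ContinuousOn w' (Icc 0 T)) (hd : ∀ t ∈ Ioo 0 T, HasDerivAt w (w' t) t) {s t : ℝ}
    (hs : 0 ≤ s) (hst : s ≤ t) (ht : t ≤ T) : w t - w s = ∫ r in s..t, w' r := by
  have hsub : Icc s t ⊆ Icc 0 T := Icc_subset_Icc hs ht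
  rw [intervalIntegral.integral_eq_sub_of_hasDerivAt_of_le hst (hw.mono hsub)
    fun r hr => hd r ⟨hs.trans_lt hr.1, hr.2.trans_le ht⟩]
  exact (hw'.mono (by rwa [uIcc_of_le hst])).intervalIntegrable

theorem exists_lipschitz_bound {T : ℝ} {w w' : ℝ → ℝ} (hw : ContinuousOn w (Icc 0 T))
    (hw' : ContinuousOn w' (Icc 0 T)) (hd : ∀ t ∈ Ioo 0 T, HasDerivAt w (w' t) t) :
    ∃ L : ℝ, 0 ≤ L ∧ ∀ s t, 0 ≤ s → s ≤ t → t ≤ T → |w t - w s| ≤ L * (t - s) := by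
  obtain ⟨L, hL⟩ := isCompact_Icc.exists_bound_of_continuousOn hw'
  refine ⟨max L 0, le_max_right _ _, fun s t hs hst ht => ?_⟩
  rw [sub_eq_integral_deriv hw hw' hd hs hst ht, ← abs_of_nonneg (sub_nonneg.2 hst),
    ← Real.norm_eq_abs]
  refine intervalIntegral.norm_integral_le_of_norm_le_const fun r hr => ?_
  rw [uIoc_of_le hst] at hr
  exact (hL r ⟨hs.trans hr.1.le, hr.2.trans ht⟩).trans (le_max_left _ _)

/-- Integration by parts in `J^(1 - σ) w'`, with `w t - w s` as the antiderivative of `-w' s` in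
`s`. The boundary term at `s = t` vanishes because `w` is Lipschitz and `σ < 1`. -/
theorem fracInt_deriv_eq {T σ : ℝ} (hσ0 : 0 < σ) (hσ1 : σ < 1) {w w' : ℝ → ℝ}
    (hw : ContinuousOn w (Icc 0 T)) (hw' : ContinuousOn w' (Icc 0 T))
    (hd : ∀ t ∈ Ioo 0 T, HasDerivAt w (w' t) t) (h0 : w 0 = 0) {t : ℝ} (ht : t ∈ Ioo 0 T) :
    fracInt (1 - σ) w' t = 1 / Real.Gamma (1 - σ) *
      (t ^ (-σ) * w t + σ * ∫ s in (0 : ℝ)..t, (w t - w s) * (t - s) ^ (-1 - σ)) := by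
  obtain ⟨L, hL0, hLip⟩ := exists_lipschitz_bound hw hw' hd
  have hsub : Icc 0 t ⊆ Icc 0 T := Icc_subset_Icc_right ht.2.le
  have hpow : IntervalIntegrable (fun s : ℝ => (t - s) ^ (-σ)) volume 0 t := by
    have := (intervalIntegral.intervalIntegrable_rpow' (a := t) (b := 0) (r := -σ)
      (by linarith)).comp_sub_left t
    simpa using this
  have hi1 : IntervalIntegrable (fun s => (t - s) ^ (-σ) * w' s) volume 0 t :=
    hpow.mul_continuousOn (hw'.mono (by rwa [uIcc_of_le ht.1.le]))
  have hi2 : IntervalIntegrable (fun s => (w t - w s) * (t - s) ^ (-1 - σ)) volume 0 t := by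
    rw [intervalIntegrable_iff_integrableOn_Ioo_of_le ht.1.le] at hpow ⊢
    refine Integrable.mono' (hpow.const_mul L) ?_ ?_
    · refine ContinuousOn.aestronglyMeasurable ?_ measurableSet_Ioo
      refine ContinuousOn.mul (continuousOn_const.sub
        (hw.mono (Ioo_subset_Icc_self.trans hsub))) ?_
      refine ContinuousOn.rpow_const (by fun_prop) fun s hs => Or.inl ?_
      exact (sub_pos.2 hs.2).ne'
    · filter_upwards [ae_restrict_mem measurableSet_Ioo] with s hs
      have h1 : 0 < t - s := sub_pos.2 hs.2
      rw [norm_mul, Real.norm_eq_abs, Real.norm_of_nonneg (by positivity)]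
      calc |w t - w s| * (t - s) ^ (-1 - σ) ≤ L * (t - s) * (t - s) ^ (-1 - σ) := by
            gcongr
            exact hLip s t hs.1.le hs.2.le ht.2.le
        _ = L * (t - s) ^ (-σ) := by
            rw [mul_assoc, ← Real.rpow_one_add' h1.le (by linarith)]
            congr 2; ring
  have hcont : ContinuousOn (fun s => (t - s) ^ (-σ) * (w t - w s)) (Icc 0 t) := by
    intro s hs
    rcases hs.2.lt_or_eq with hlt | rfl
    · refine ContinuousWithinAt.mul ?_ (continuousWithinAt_const.sub ((hw s (hsub hs)).mono hsub))
      refine ContinuousWithinAt.rpow_const (by fun_prop) (Or.inl (sub_pos.2 hlt).ne')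
    · rw [ContinuousWithinAt, sub_self (w s), mul_zero]
      have hb : Tendsto (fun r => L * (s - r) ^ (1 - σ)) (𝓝[Icc 0 s] s) (𝓝 0) := by
        have hc : Continuous fun r : ℝ => L * (s - r) ^ (1 - σ) :=
          continuous_const.mul ((Real.continuous_rpow_const (by linarith)).comp
            (continuous_const.sub continuous_id))
        have := (hc.tendsto s).mono_left (nhdsWithin_le_nhds (s := Icc 0 s))
        simpa [Real.zero_rpow (show 1 - σ ≠ 0 by linarith)] using this
      refine squeeze_zero_norm' ?_ hb
      filter_upwards [self_mem_nhdsWithin] with r hr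
      have h1 : 0 ≤ s - r := sub_nonneg.2 hr.2
      rw [norm_mul, Real.norm_of_nonneg (by positivity), Real.norm_eq_abs]
      calc (s - r) ^ (-σ) * |w s - w r| ≤ (s - r) ^ (-σ) * (L * (s - r)) := by
            gcongr
            exact hLip r s hr.1 hr.2 ht.2.le
        _ = L * (s - r) ^ (1 - σ) := by
            rw [sub_eq_add_neg 1 σ, Real.rpow_one_add' h1 (by linarith)]
            ring
  have hderiv : ∀ s ∈ Ioo 0 t, HasDerivAt (fun s => (t - s) ^ (-σ) * (w t - w s))
      (σ * ((w t - w s) * (t - s) ^ (-1 - σ)) - (t - s) ^ (-σ) * w' s) s := by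
    intro s hs
    have h1 : HasDerivAt (fun s => t - s) (-1) s := (hasDerivAt_id s).const_sub t
    have h2 := (h1.rpow_const (p := -σ) (Or.inl (sub_pos.2 hs.2).ne')).mul
      ((hd s ⟨hs.1, hs.2.trans ht.2⟩).const_sub (w t))
    refine h2.congr_deriv ?_
    rw [show -σ - 1 = -1 - σ by ring]
    ring
  have key := intervalIntegral.integral_eq_sub_of_hasDerivAt_of_le ht.1.le hcont hderiv
    ((hi2.const_mul σ).sub hi1)
  rw [intervalIntegral.integral_sub (hi2.const_mul σ) hi1, intervalIntegral.integral_const_mul,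
    h0] at key
  simp only [sub_self, mul_zero, sub_zero, zero_sub] at key
  rw [fracInt, show 1 - σ - 1 = -σ by ring]
  congr 1
  linarith

theorem enorm_fracInt_deriv_le {T σ : ℝ} (hσ0 : 0 < σ) (hσ1 : σ < 1) {w w' : ℝ → ℝ}
    (hw : ContinuousOn w (Icc 0 T)) (hw' : ContinuousOn w' (Icc 0 T))
    (hd : ∀ t ∈ Ioo 0 T, HasDerivAt w (w' t) t) (h0 : w 0 = 0) {t : ℝ} (ht : t ∈ Ioo 0 T) :
    ‖fracInt (1 - σ) w' t‖ₑ ≤ ‖1 / Real.Gamma (1 - σ)‖ₑ *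
      (ENNReal.ofReal (t ^ (-σ)) * ‖w t‖ₑ +
        ∫⁻ s in Ioo 0 t, ‖w t - w s‖ₑ * ENNReal.ofReal ((t - s) ^ (-1 - σ))) := by
  have ht0 := ht.1
  rw [fracInt_deriv_eq hσ0 hσ1 hw hw' hd h0 ht, enorm_mul]
  gcongr
  refine (enorm_add_le _ _).trans ?_
  rw [enorm_mul, enorm_mul, Real.enorm_of_nonneg (by positivity : 0 ≤ t ^ (-σ)),
    Real.enorm_of_nonneg hσ0.le]
  gcongr
  refine (mul_le_of_le_one_left' (ENNReal.ofReal_le_one.2 hσ1.le)).trans ?_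
  rw [intervalIntegral.integral_of_le ht0.le, integral_Ioc_eq_integral_Ioo]
  refine (enorm_integral_le_lintegral_enorm _).trans_eq ?_
  refine setLIntegral_congr_fun measurableSet_Ioo fun s hs => ?_
  have h1 : 0 < t - s := sub_pos.2 hs.2
  simp only [enorm_mul]
  rw [Real.enorm_of_nonneg (by positivity : 0 ≤ (t - s) ^ (-1 - σ))]

theorem gagliardo_le_of_le {T ρ τ p : ℝ} (hp : 1 ≤ p) (hρτ : ρ ≤ τ) (g : ℝ → ℝ) :
    gagliardo T ρ p g ≤ ENNReal.ofReal (T ^ ((τ - ρ) * p)) * gagliardo T τ p g := by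
  have hp0 : 0 < p := by linarith
  unfold gagliardo
  rw [← lintegral_const_mul' _ _ ENNReal.ofReal_ne_top]
  refine setLIntegral_mono_ae' measurableSet_Ioo (ae_of_all _ fun s hs => ?_)
  rw [← lintegral_const_mul' _ _ ENNReal.ofReal_ne_top]
  refine setLIntegral_mono_ae' measurableSet_Ioo (ae_of_all _ fun t ht => ?_)
  have hT : 0 < T := hs.1.trans hs.2
  rw [← ENNReal.ofReal_mul (by positivity)]
  refine ENNReal.ofReal_le_ofReal ?_
  rcases eq_or_ne t s with rfl | hne
  · simp [Real.zero_rpow hp0.ne']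
  · have hpos : 0 < |t - s| := abs_pos.2 (sub_ne_zero.2 hne)
    have hle : |t - s| ≤ T := by
      rw [abs_le]; constructor <;> linarith [hs.1, hs.2, ht.1, ht.2]
    have h3 : |t - s| ^ ((τ - ρ) * p) ≤ T ^ ((τ - ρ) * p) :=
      Real.rpow_le_rpow hpos.le hle (mul_nonneg (sub_nonneg.2 hρτ) hp0.le)
    rw [← mul_div_assoc, div_le_div_iff₀ (by positivity) (by positivity)]
    calc |g t - g s| ^ p * |t - s| ^ (1 + τ * p)
        = |t - s| ^ ((τ - ρ) * p) * |g t - g s| ^ p * |t - s| ^ (1 + ρ * p) := by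
          rw [show 1 + τ * p = (τ - ρ) * p + (1 + ρ * p) by ring, Real.rpow_add hpos]; ring
      _ ≤ _ := by gcongr

/-- The finiteness needed in the Hardy inequality holds for `C¹` functions vanishing at `0`, as they
are `O(t)`. -/
theorem lintegral_rpow_mul_ne_top {T ρ p : ℝ} (hp : 1 ≤ p) (hρ1 : ρ ≤ 1)
    {w w' : ℝ → ℝ} (hw : ContinuousOn w (Icc 0 T)) (hw' : ContinuousOn w' (Icc 0 T))
    (hd : ∀ t ∈ Ioo 0 T, HasDerivAt w (w' t) t) (h0 : w 0 = 0) :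
    ∫⁻ t in Ioo 0 T, ENNReal.ofReal (t ^ (-(ρ * p))) * ‖w t‖ₑ ^ p ≠ ⊤ := by
  have hp0 : 0 < p := by linarith
  obtain ⟨L, hL0, hLip⟩ := exists_lipschitz_bound hw hw' hd
  have hb : ∀ t ∈ Ioo 0 T, ENNReal.ofReal (t ^ (-(ρ * p))) * ‖w t‖ₑ ^ p ≤
      ENNReal.ofReal (L ^ p * T ^ ((1 - ρ) * p)) := by
    intro t ht
    have ht0 := ht.1
    have h1 : |w t| ≤ L * t := by simpa [h0] using hLip 0 t le_rfl ht.1.le ht.2.le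
    rw [← ofReal_norm, Real.norm_eq_abs, ENNReal.ofReal_rpow_of_nonneg (abs_nonneg _) hp0.le,
      ← ENNReal.ofReal_mul (by positivity)]
    refine ENNReal.ofReal_le_ofReal ?_
    calc t ^ (-(ρ * p)) * |w t| ^ p ≤ t ^ (-(ρ * p)) * (L * t) ^ p := by gcongr
      _ = L ^ p * t ^ ((1 - ρ) * p) := by
        rw [Real.mul_rpow hL0 ht0.le, show (1 - ρ) * p = -(ρ * p) + p by ring, Real.rpow_add ht0]
        ring
      _ ≤ _ := by
        gcongr
        exact ht.2.le
  refine ne_top_of_le_ne_top ?_ (setLIntegral_mono_ae' measurableSet_Ioo (ae_of_all _ hb))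
  rw [setLIntegral_const, Real.volume_Ioo]
  finiteness

/-- The estimate of the top order derivative: `d/dt J^(1 - σ) w = J^(1 - σ) w'` is bounded in
`L^p` by the `W^{τ,p}` norm of `w`, for `σ < τ`. -/
theorem exists_lintegral_fracInt_deriv_le {T σ τ p : ℝ} (hT : 0 < T) (hp : 1 ≤ p) (hσ0 : 0 < σ)
    (hστ : σ < τ) (hτ1 : τ < 1) :
    ∃ C : ℝ≥0∞, C ≠ ⊤ ∧ ∀ w w' : ℝ → ℝ, ContinuousOn w (Icc 0 T) → ContinuousOn w' (Icc 0 T) →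
      (∀ t ∈ Ioo 0 T, HasDerivAt w (w' t) t) → w 0 = 0 →
      ∫⁻ t in Ioo 0 T, ‖fracInt (1 - σ) w' t‖ₑ ^ p ≤
        C * ((∫⁻ t in Ioo 0 T, ‖w t‖ₑ ^ p) + gagliardo T τ p w) := by
  have hp0 : 0 < p := by linarith
  -- The Hardy inequality excludes the critical exponent `ρ * p = 1`, but any `ρ` in `[σ, τ]` with
  -- `ρ * p ≠ 1` will do.
  obtain ⟨ρ, hσρ, hρτ, hρp⟩ : ∃ ρ, σ ≤ ρ ∧ ρ ≤ τ ∧ ρ * p ≠ 1 := by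
    by_cases h : σ * p = 1
    · exact ⟨τ, hστ.le, le_rfl, by nlinarith [mul_lt_mul_of_pos_right hστ hp0]⟩
    · exact ⟨σ, le_rfl, hστ.le, h⟩
  obtain ⟨C₁, hC₁, H₁⟩ := exists_hardy_le (T := T) hp (hσ0.trans_le hσρ) hρp hT
  obtain ⟨C₂, hC₂, H₂⟩ := exists_singular_le (T := T) hp hστ
  set c₀ : ℝ≥0∞ := ‖1 / Real.Gamma (1 - σ)‖ₑ ^ p * 2 ^ (p - 1) with hc₀
  have hc₀t : c₀ ≠ ⊤ := ENNReal.mul_ne_top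
    (ENNReal.rpow_ne_top_of_nonneg hp0.le (by finiteness))
    (ENNReal.rpow_ne_top_of_nonneg (by linarith) (by simp))
  set c₁ : ℝ≥0∞ := ENNReal.ofReal (T ^ ((ρ - σ) * p)) with hc₁
  set c₂ : ℝ≥0∞ := ENNReal.ofReal (T ^ ((τ - ρ) * p)) with hc₂
  refine ⟨c₀ * (c₁ * C₁ * (1 + c₂) + C₂), by finiteness, fun w w' hw hw' hd h0 => ?_⟩
  have hwm : AEMeasurable w (volume.restrict (Ioo 0 T)) :=
    (hw.mono Ioo_subset_Icc_self).aemeasurable measurableSet_Ioo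
  set N := ∫⁻ t in Ioo 0 T, ‖w t‖ₑ ^ p
  have hA := H₁ w hwm (lintegral_rpow_mul_ne_top hp (hρτ.trans hτ1.le) hw hw' hd h0)
  calc ∫⁻ t in Ioo 0 T, ‖fracInt (1 - σ) w' t‖ₑ ^ p
      ≤ ∫⁻ t in Ioo 0 T, c₀ * (c₁ * (ENNReal.ofReal (t ^ (-(ρ * p))) * ‖w t‖ₑ ^ p) +
          (∫⁻ s in Ioo 0 t, ‖w t - w s‖ₑ * ENNReal.ofReal ((t - s) ^ (-1 - σ))) ^ p) := by
        refine setLIntegral_mono_ae' measurableSet_Ioo (ae_of_all _ fun t ht => ?_)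
        have ht0 := ht.1
        refine (ENNReal.rpow_le_rpow (enorm_fracInt_deriv_le hσ0 (hστ.trans hτ1) hw hw' hd h0 ht)
          hp0.le).trans ?_
        rw [ENNReal.mul_rpow_of_nonneg _ _ hp0.le, hc₀, mul_assoc]
        gcongr
        refine (ENNReal.rpow_add_le_mul_rpow_add_rpow _ _ hp).trans ?_
        gcongr
        rw [ENNReal.mul_rpow_of_nonneg _ _ hp0.le, ← mul_assoc,
          ENNReal.ofReal_rpow_of_nonneg (by positivity) hp0.le, hc₁,
          ← ENNReal.ofReal_mul (by positivity)]
        gcongr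
        calc (t ^ (-σ)) ^ p = t ^ ((ρ - σ) * p) * t ^ (-(ρ * p)) := by
              rw [← Real.rpow_mul ht0.le, ← Real.rpow_add ht0]; congr 1; ring
          _ ≤ _ := by
              gcongr
              exact ht.2.le
    _ = c₀ * (c₁ * (∫⁻ t in Ioo 0 T, ENNReal.ofReal (t ^ (-(ρ * p))) * ‖w t‖ₑ ^ p) +
          ∫⁻ t in Ioo 0 T,
            (∫⁻ s in Ioo 0 t, ‖w t - w s‖ₑ * ENNReal.ofReal ((t - s) ^ (-1 - σ))) ^ p) := by
        rw [lintegral_const_mul' _ _ hc₀t, lintegral_add_left',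
          lintegral_const_mul' _ _ ENNReal.ofReal_ne_top]
        fun_prop
    _ ≤ c₀ * (c₁ * (C₁ * (N + c₂ * gagliardo T τ p w)) + C₂ * gagliardo T τ p w) := by
        gcongr
        · exact hA.trans (by gcongr; exact gagliardo_le_of_le hp hρτ w)
        · exact H₂ w hwm
    _ ≤ c₀ * (c₁ * (C₁ * ((1 + c₂) * (N + gagliardo T τ p w))) +
          C₂ * (N + gagliardo T τ p w)) := by
        gcongr
        · calc N + c₂ * gagliardo T τ p w
              ≤ N + c₂ * gagliardo T τ p w + (c₂ * N + gagliardo T τ p w) := le_self_add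
            _ = _ := by ring
        · exact le_add_self
    _ = _ := by ring

/-! ### Weak derivatives of fractional integrals of smooth functions -/

/-- Fubini: testing `J^a u` against `χ` amounts to averaging, over shifts `r`, the tests of `u`
against `χ (· + r)`. -/
theorem setIntegral_fracInt_mul {T a : ℝ} (ha : 0 < a) {u χ : ℝ → ℝ}
    (hu : IntegrableOn u (Ioo 0 T)) (hχ : Continuous χ) (hc : HasCompactSupport χ)
    (hs : tsupport χ ⊆ Ioo 0 T) :
    ∫ t in Ioo 0 T, fracInt a u t * χ t =
      1 / Real.Gamma a * ∫ r, rlKernel T a r * ∫ s in Ioo 0 T, u s * χ (s + r) := by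
  obtain ⟨B, hB⟩ := hχ.bounded_above_of_compact_support hc
  have hU : Integrable ((Ioo 0 T).indicator u) := (integrable_indicator_iff measurableSet_Ioo).2 hu
  have hint : Integrable (fun z : ℝ × ℝ =>
      rlKernel T a z.2 * (Ioo 0 T).indicator u (z.1 - z.2) * χ z.1) (volume.prod volume) :=
    (Integrable.convolution_integrand (ContinuousLinearMap.mul ℝ ℝ)
      (integrable_rlKernel T ha) hU).mul_bdd (hχ.comp continuous_fst).aestronglyMeasurable
      (ae_of_all _ fun z => hB z.1)
  calc ∫ t in Ioo 0 T, fracInt a u t * χ t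
      = ∫ t in Ioo 0 T, 1 / Real.Gamma a *
          ∫ r, rlKernel T a r * (Ioo 0 T).indicator u (t - r) * χ t := by
        refine setIntegral_congr_fun measurableSet_Ioo fun t ht => ?_
        rw [fracInt_eq_integral ht, integral_mul_const, mul_assoc]
        congr 2
        rw [← integral_sub_left_eq_self
          (fun r => rlKernel T a r * (Ioo 0 T).indicator u (t - r)) volume t]
        simp only [sub_sub_cancel, mul_comm]
    _ = 1 / Real.Gamma a * ∫ t, ∫ r, rlKernel T a r * (Ioo 0 T).indicator u (t - r) * χ t := by
        rw [integral_const_mul]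
        congr 1
        refine setIntegral_eq_integral_of_forall_compl_eq_zero fun t ht => ?_
        have : χ t = 0 := image_eq_zero_of_notMem_tsupport fun h => ht (hs h)
        simp [this]
    _ = 1 / Real.Gamma a * ∫ r, ∫ t, rlKernel T a r * (Ioo 0 T).indicator u (t - r) * χ t := by
        rw [integral_integral_swap hint]
    _ = _ := by
        congr 2
        ext r
        rw [← integral_indicator measurableSet_Ioo, ← integral_sub_right_eq_self
          (fun s => (Ioo 0 T).indicator (fun s => u s * χ (s + r)) s) r, ← integral_const_mul]
        congr 1
        ext t
        by_cases h : t - r ∈ Ioo 0 T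
        · simp [h, mul_assoc]
        · simp [h]

theorem MemZeroC.hasDerivAt_iteratedDerivWithin {T : ℝ} {m k : ℕ} {v : ℝ → ℝ}
    (hv : MemZeroC T m v) (hT : 0 < T)
    (hk : k < m) {t : ℝ} (ht : t ∈ Ioo 0 T) :
    HasDerivAt (iteratedDerivWithin k v (Icc 0 T)) (iteratedDerivWithin (k + 1) v (Icc 0 T) t)
      t := by
  have h := hv.1.differentiableOn_iteratedDerivWithin (m := k) (by exact_mod_cast hk)
    (uniqueDiffOn_Icc hT) t (Ioo_subset_Icc_self ht)
  rw [iteratedDerivWithin_succ]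
  exact h.hasDerivWithinAt.hasDerivAt (Icc_mem_nhds ht.1 ht.2)

theorem MemZeroC.continuousOn_iteratedDerivWithin {T : ℝ} {m k : ℕ} {v : ℝ → ℝ}
    (hv : MemZeroC T m v) (hT : 0 < T)
    (hk : k ≤ m) : ContinuousOn (iteratedDerivWithin k v (Icc 0 T)) (Icc 0 T) :=
  hv.1.continuousOn_iteratedDerivWithin (by exact_mod_cast hk) (uniqueDiffOn_Icc hT)

theorem MemZeroC.sub {T : ℝ} {m : ℕ} {v w : ℝ → ℝ} (hT : 0 < T) (hv : MemZeroC T m v)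
    (hw : MemZeroC T m w) : MemZeroC T m (v - w) := by
  refine ⟨hv.1.sub hw.1, fun k hk => ?_⟩
  have h0 : (0 : ℝ) ∈ Icc 0 T := left_mem_Icc.2 hT.le
  have hk' : (k : WithTop ℕ∞) ≤ m := by exact_mod_cast hk.le
  rw [iteratedDerivWithin_sub h0 (uniqueDiffOn_Icc hT) ((hv.1 0 h0).of_le hk')
    ((hw.1 0 h0).of_le hk'), hv.2 k hk, hw.2 k hk, sub_zero]

theorem memLp_of_continuousOn_Icc {T : ℝ} {f : ℝ → ℝ} (hf : ContinuousOn f (Icc 0 T))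
    (q : ℝ≥0∞) : MemLp f q (volume.restrict (Ioo 0 T)) := by
  obtain ⟨L, hL⟩ := isCompact_Icc.exists_bound_of_continuousOn hf
  refine MemLp.of_bound ((hf.mono Ioo_subset_Icc_self).aestronglyMeasurable measurableSet_Ioo) L ?_
  filter_upwards [ae_restrict_mem measurableSet_Ioo] with t ht
  exact hL t (Ioo_subset_Icc_self ht)

/-- Iterated integration by parts. Since the derivatives of `v` vanish at `0`, the test function `ψ`
has to vanish only at `T`, which leaves room for shifting a test function to the left. -/
theorem setIntegral_mul_iteratedDeriv {T : ℝ} {m : ℕ} {v : ℝ → ℝ} (hT : 0 < T)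
    (hv : MemZeroC T m v) {k : ℕ} (hk : k ≤ m) {ψ : ℝ → ℝ} (hψ : ContDiff ℝ ∞ ψ)
    (h0 : ∀ j < k, iteratedDeriv j ψ T = 0) :
    ∫ t in Ioo 0 T, v t * iteratedDeriv k ψ t =
      (-1) ^ k * ∫ t in Ioo 0 T, iteratedDerivWithin k v (Icc 0 T) t * ψ t := by
  induction k generalizing ψ with
  | zero => simp
  | succ k ih =>
    have hψ' : ContDiff ℝ ∞ (deriv ψ) := by
      have := hψ.iterate_deriv 1
      simpa using this
    have h1 := ih (Nat.le_of_succ_le hk) hψ' fun j hj => by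
      rw [← iteratedDeriv_succ']; exact h0 (j + 1) (by omega)
    have hψT : ψ T = 0 := by simpa using h0 0 (Nat.succ_pos k)
    rw [iteratedDeriv_succ', h1, pow_succ, mul_assoc]
    congr 1
    have h2 := intervalIntegral.integral_mul_deriv_eq_deriv_mul_of_hasDerivAt (a := 0) (b := T)
      (u := iteratedDerivWithin k v (Icc 0 T)) (v := ψ)
      (u' := iteratedDerivWithin (k + 1) v (Icc 0 T)) (v' := deriv ψ)
      (by
        rw [uIcc_of_le hT.le]
        exact hv.continuousOn_iteratedDerivWithin hT (Nat.le_of_succ_le hk))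
      hψ.continuous.continuousOn
      (fun x hx => by
        rw [min_eq_left hT.le, max_eq_right hT.le] at hx
        exact hv.hasDerivAt_iteratedDerivWithin hT hk hx)
      (fun x _ => (hψ.differentiable (by simp) x).hasDerivAt)
      (by
        refine ContinuousOn.intervalIntegrable ?_
        rw [uIcc_of_le hT.le]
        exact hv.continuousOn_iteratedDerivWithin hT hk)
      (hψ'.continuous.intervalIntegrable _ _)
    rw [hψT, hv.2 k hk, intervalIntegral.integral_of_le hT.le,
      intervalIntegral.integral_of_le hT.le, integral_Ioc_eq_integral_Ioo,
      integral_Ioc_eq_integral_Ioo] at h2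
    rw [h2]
    ring

theorem MemZeroC.hasWeakDeriv {T : ℝ} {m k : ℕ} {v : ℝ → ℝ} (hT : 0 < T)
    (hv : MemZeroC T m v) (hk : k ≤ m) :
    HasWeakDeriv T k v (iteratedDerivWithin k v (Icc 0 T)) := by
  have hint : ∀ f : ℝ → ℝ, ContinuousOn f (Icc 0 T) → LocallyIntegrableOn f (Ioo 0 T) :=
    fun f hf => (integrableOn_of_memLp le_rfl (memLp_of_continuousOn_Icc hf _)).locallyIntegrableOn
  refine ⟨hint _ hv.1.continuousOn, hint _ (hv.continuousOn_iteratedDerivWithin hT hk),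
    fun φ hφ hc hs => ?_⟩
  refine setIntegral_mul_iteratedDeriv hT hv hk hφ fun j _ => ?_
  exact image_eq_zero_of_notMem_tsupport fun h =>
    lt_irrefl T (hs (tsupport_iteratedDeriv_subset φ j h)).2

/-- On `₀C^m[0,T]`, fractional integration commutes with differentiation. -/
theorem MemZeroC.hasWeakDeriv_fracInt {T a : ℝ} {m k : ℕ} {v : ℝ → ℝ} (hT : 0 < T)
    (ha : 0 < a) (hv : MemZeroC T m v) (hk : k ≤ m) :
    HasWeakDeriv T k (fracInt a v) (fracInt a (iteratedDerivWithin k v (Icc 0 T))) := by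
  have hint : ∀ f : ℝ → ℝ, ContinuousOn f (Icc 0 T) → IntegrableOn f (Ioo 0 T) :=
    fun f hf => integrableOn_of_memLp le_rfl (memLp_of_continuousOn_Icc hf _)
  have hiv := hint _ hv.1.continuousOn
  have hik := hint _ (hv.continuousOn_iteratedDerivWithin hT hk)
  refine ⟨(integrableOn_fracInt ha hiv).locallyIntegrableOn,
    (integrableOn_fracInt ha hik).locallyIntegrableOn, fun φ hφ hc hs => ?_⟩
  rw [setIntegral_fracInt_mul ha hiv (continuous_iteratedDeriv_of_smooth hφ k)
      (hasCompactSupport_iteratedDeriv hc k) ((tsupport_iteratedDeriv_subset φ k).trans hs),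
    setIntegral_fracInt_mul ha hik hφ.continuous hc hs, mul_left_comm ((-1 : ℝ) ^ k),
    ← integral_const_mul ((-1 : ℝ) ^ k)]
  congr 2
  ext r
  by_cases hr : r ∈ Ioo 0 T
  · rw [mul_left_comm]
    congr 1
    have h1 := setIntegral_mul_iteratedDeriv hT hv hk (ψ := fun s => φ (s + r))
      (hφ.comp (contDiff_id.add contDiff_const)) fun j _ => by
        rw [iteratedDeriv_comp_add_const]
        refine image_eq_zero_of_notMem_tsupport fun h => ?_
        have := (hs (tsupport_iteratedDeriv_subset φ j h)).2
        linarith [hr.1]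
    simpa only [iteratedDeriv_comp_add_const] using h1
  · simp [rlKernel, hr]

/-! ### Passage to the closure -/

theorem MemZeroC.memSobolev {T p : ℝ} {m n : ℕ} {v : ℝ → ℝ} (hT : 0 < T)
    (hv : MemZeroC T m v) (hn : n ≤ m) : MemSobolev T n p v := fun _ hk =>
  ⟨_, hv.hasWeakDeriv hT (hk.trans hn),
    memLp_of_continuousOn_Icc (hv.continuousOn_iteratedDerivWithin hT (hk.trans hn)) _⟩

theorem MemSobolev.sub {T p : ℝ} {n : ℕ} {u v : ℝ → ℝ} (hu : MemSobolev T n p u)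
    (hv : MemSobolev T n p v) : MemSobolev T n p (u - v) := fun _ hk =>
  ⟨_, (hu.hasWeakDeriv hk).sub (hv.hasWeakDeriv hk), (hu.memLp hk).sub (hv.memLp hk)⟩

/-- The a priori estimate on `₀C^{n+1}[0,T]`, `n = ⌊β⌋`. Orders `k ≤ n` follow from the `L^p`
bound of the fractional integral, order `n + 1` from the Hardy and singular integral bounds. -/
theorem exists_eLpNorm_fracInt_iteratedDeriv_le {T p σ β : ℝ} (hT : 0 < T) (hp : 1 ≤ p)
    (hσ0 : 0 < σ) (hσβ : σ < Int.fract β) {k : ℕ} (hk : k ≤ ⌊β⌋₊ + 1) :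
    ∃ C : ℝ≥0∞, C ≠ ⊤ ∧ ∀ v : ℝ → ℝ, MemZeroC T (⌊β⌋₊ + 1) v →
      eLpNorm (fracInt (1 - σ) (iteratedDerivWithin k v (Icc 0 T))) (ENNReal.ofReal p)
        (volume.restrict (Ioo 0 T)) ≤ C * slobodeckiNorm T β p v := by
  have hp0 : 0 < p := by linarith
  have hτ1 : Int.fract β < 1 := Int.fract_lt_one β
  rcases Nat.lt_succ_iff_lt_or_eq.1 (Nat.lt_succ_of_le hk) with hlt | rfl
  · have hkn : k ≤ ⌊β⌋₊ := Nat.lt_succ_iff.1 hlt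
    obtain ⟨C, hC, H⟩ := exists_eLpNorm_fracInt_le T hp (a := 1 - σ) (by linarith)
    refine ⟨C, hC, fun v hv => ?_⟩
    have hcont := hv.continuousOn_iteratedDerivWithin hT hk
    refine (H _ ((hcont.mono Ioo_subset_Icc_self).aemeasurable measurableSet_Ioo)).trans ?_
    gcongr
    rw [← eLpNorm_congr_ae (hv.hasWeakDeriv hT hk).weakDeriv_ae_eq]
    exact eLpNorm_weakDeriv_le_slobodeckiNorm hp v hkn
  · obtain ⟨C, hC, H⟩ := exists_lintegral_fracInt_deriv_le hT hp hσ0 hσβ hτ1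
    refine ⟨(2 * C) ^ (1 / p), ENNReal.rpow_ne_top_of_nonneg (by positivity) (by finiteness),
      fun v hv => ?_⟩
    set n := ⌊β⌋₊ with hn
    have hw := (hv.hasWeakDeriv hT n.le_succ).weakDeriv_ae_eq
    have h := H _ _ (hv.continuousOn_iteratedDerivWithin hT n.le_succ)
      (hv.continuousOn_iteratedDerivWithin hT le_rfl)
      (fun t ht => hv.hasDerivAt_iteratedDerivWithin hT n.lt_succ_self ht) (hv.2 n n.lt_succ_self)
    rw [← eLpNorm_rpow_eq_lintegral hp, ← eLpNorm_rpow_eq_lintegral hp, ← gagliardo_congr hw,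
      ← eLpNorm_congr_ae hw] at h
    rw [← ENNReal.rpow_le_rpow_iff hp0, ENNReal.mul_rpow_of_nonneg _ _ hp0.le,
      ← ENNReal.rpow_mul, one_div_mul_cancel hp0.ne', ENNReal.rpow_one]
    calc _ ≤ _ := h
      _ ≤ C * (slobodeckiNorm T β p v ^ p + slobodeckiNorm T β p v ^ p) := by
          gcongr
          · exact eLpNorm_weakDeriv_le_slobodeckiNorm hp v le_rfl
          · exact gagliardo_le_slobodeckiNorm hp v
      _ = _ := by ring

theorem fracInt_iteratedDeriv_sub_ae {T a : ℝ} {m k : ℕ} {v w : ℝ → ℝ} (hT : 0 < T) (ha : 0 < a)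
    (hv : MemZeroC T m v) (hw : MemZeroC T m w) (hk : k ≤ m) :
    fracInt a (iteratedDerivWithin k (v - w) (Icc 0 T)) =ᵐ[volume.restrict (Ioo 0 T)]
      fracInt a (iteratedDerivWithin k v (Icc 0 T)) -
        fracInt a (iteratedDerivWithin k w (Icc 0 T)) := by
  have hint : ∀ f : ℝ → ℝ, ContinuousOn f (Icc 0 T) → IntegrableOn f (Ioo 0 T) :=
    fun f hf => integrableOn_of_memLp le_rfl (memLp_of_continuousOn_Icc hf _)
  have hk' : (k : WithTop ℕ∞) ≤ m := by exact_mod_cast hk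
  have e : iteratedDerivWithin k (v - w) (Icc 0 T) =ᵐ[volume.restrict (Ioo 0 T)]
      iteratedDerivWithin k v (Icc 0 T) - iteratedDerivWithin k w (Icc 0 T) := by
    filter_upwards [ae_restrict_mem measurableSet_Ioo] with t ht
    have ht' := Ioo_subset_Icc_self ht
    exact iteratedDerivWithin_sub ht' (uniqueDiffOn_Icc hT) ((hv.1 t ht').of_le hk')
      ((hw.1 t ht').of_le hk')
  refine EventuallyEq.trans ?_ (fracInt_sub_ae ha
    (hint _ (hv.continuousOn_iteratedDerivWithin hT hk))
    (hint _ (hw.continuousOn_iteratedDerivWithin hT hk)))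
  filter_upwards [ae_restrict_mem measurableSet_Ioo] with t ht
  exact fracInt_congr_ae e ht

/-- An a priori estimate on `₀C^{n+1}[0,T]` extends to its closure: along an approximating
sequence the `k`-th derivatives form a Cauchy sequence in `L^p`, and weak differentiation is
closed. -/
theorem exists_hasWeakDeriv_fracInt_le {T p a β : ℝ} (hT : 0 < T) (hp : 1 ≤ p) (ha : 0 < a)
    {k : ℕ} (hk : k ≤ ⌊β⌋₊ + 1) {C : ℝ≥0∞} (hC : C ≠ ⊤)
    (H : ∀ v : ℝ → ℝ, MemZeroC T (⌊β⌋₊ + 1) v →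
      eLpNorm (fracInt a (iteratedDerivWithin k v (Icc 0 T))) (ENNReal.ofReal p)
        (volume.restrict (Ioo 0 T)) ≤ C * slobodeckiNorm T β p v)
    {u : ℝ → ℝ} (hu : MemZeroSlobodecki T β p u) :
    ∃ g, HasWeakDeriv T k (fracInt a u) g ∧
      MemLp g (ENNReal.ofReal p) (volume.restrict (Ioo 0 T)) ∧
      eLpNorm g (ENNReal.ofReal p) (volume.restrict (Ioo 0 T)) ≤
        3 * C * slobodeckiNorm T β p u := by
  have hp' : (1 : ℝ≥0∞) ≤ ENNReal.ofReal p := by simpa using hp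
  -- `D` dominates the constant `6 * C` of the Cauchy estimate below and is never `0`.
  set D : ℝ≥0∞ := 6 * C + 1 with hD
  have hD0 : D ≠ 0 := by simp [hD]
  have hDt : D ≠ ⊤ := by finiteness
  set δ : ℕ → ℝ≥0∞ := fun j => (1 / 2) ^ j / D with hδ
  have hhalf : ∀ j : ℕ, (1 / 2 : ℝ≥0∞) ^ j ≠ 0 := fun j => pow_ne_zero j (by simp)
  have hhalft : ∀ j : ℕ, (1 / 2 : ℝ≥0∞) ^ j ≠ ⊤ := fun j =>
    ENNReal.pow_ne_top (by simp)
  have hδ0 : ∀ j, 0 < δ j := fun j => ENNReal.div_pos (hhalf j) hDt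
  have hDδ : ∀ j, D * δ j = (1 / 2) ^ j := fun j => ENNReal.mul_div_cancel hD0 hDt
  have hδanti : ∀ i j, i ≤ j → δ j ≤ δ i := fun i j hij => by
    refine ENNReal.div_le_div_right (pow_le_pow_right_of_le_one' ?_ hij) D
    simp
  have hδlim : Tendsto δ atTop (𝓝 0) := by
    have := ENNReal.tendsto_pow_atTop_nhds_zero_of_lt_one (r := 1 / 2) (by simp)
    simpa [hδ] using ENNReal.Tendsto.div_const this (Or.inr hD0)
  choose v hv hvδ using fun j => hu.2 (δ j) (hδ0 j)
  have hus := hu.1.1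
  have hvs : ∀ j, MemSobolev T ⌊β⌋₊ p (v j) := fun j =>
    (hv j).memSobolev hT (Nat.le_succ _)
  set V : ℕ → ℝ → ℝ := fun j => iteratedDerivWithin k (v j) (Icc 0 T) with hV
  have hVc : ∀ j, ContinuousOn (V j) (Icc 0 T) := fun j =>
    (hv j).continuousOn_iteratedDerivWithin hT hk
  obtain ⟨K, hK, HK⟩ := exists_eLpNorm_fracInt_le T hp ha
  have hmem : ∀ f : ℝ → ℝ, MemLp f (ENNReal.ofReal p) (volume.restrict (Ioo 0 T)) →
      MemLp (fracInt a f) (ENNReal.ofReal p) (volume.restrict (Ioo 0 T)) := fun f hf =>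
    ⟨(integrableOn_fracInt ha (integrableOn_of_memLp hp hf)).1,
      (HK f hf.1.aemeasurable).trans_lt (ENNReal.mul_lt_top hK.lt_top hf.2)⟩
  have hGmem : ∀ j, MemLp (fracInt a (V j)) (ENNReal.ofReal p) (volume.restrict (Ioo 0 T)) :=
    fun j => hmem _ (memLp_of_continuousOn_Icc (hVc j) _)
  have hcau : ∀ N i j : ℕ, N ≤ i → N ≤ j →
      eLpNorm (fracInt a (V i) - fracInt a (V j)) (ENNReal.ofReal p)
        (volume.restrict (Ioo 0 T)) < 2 * (1 / 2) ^ N := by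
    intro N i j hi hj
    calc eLpNorm (fracInt a (V i) - fracInt a (V j)) (ENNReal.ofReal p)
          (volume.restrict (Ioo 0 T))
        = eLpNorm (fracInt a (iteratedDerivWithin k (v i - v j) (Icc 0 T))) (ENNReal.ofReal p)
          (volume.restrict (Ioo 0 T)) :=
          (eLpNorm_congr_ae (fracInt_iteratedDeriv_sub_ae hT ha (hv i) (hv j) hk)).symm
      _ ≤ C * slobodeckiNorm T β p (v i - v j) := H _ ((hv i).sub hT (hv j))
      _ = C * slobodeckiNorm T β p ((u - v j) - (u - v i)) := by rw [sub_sub_sub_cancel_left]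
      _ ≤ C * (3 * (δ N + δ N)) := by
          gcongr
          refine (slobodeckiNorm_sub_le hp (hus.sub (hvs j)) (hus.sub (hvs i))).trans ?_
          gcongr
          · exact (hvδ j).le.trans (hδanti _ _ hj)
          · exact (hvδ i).le.trans (hδanti _ _ hi)
      _ ≤ D * δ N := by
          calc C * (3 * (δ N + δ N)) = 6 * C * δ N := by ring
            _ ≤ D * δ N := by gcongr; exact le_self_add
      _ = (1 / 2) ^ N := hDδ N
      _ < 2 * (1 / 2) ^ N := by
          rw [two_mul]
          exact ENNReal.lt_add_right (hhalft N) (hhalf N)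
  have hsum : ∑' N : ℕ, 2 * (1 / 2 : ℝ≥0∞) ^ N ≠ ⊤ := by
    rw [ENNReal.tsum_mul_left, ENNReal.tsum_geometric]
    simp [ENNReal.mul_eq_top]
  obtain ⟨g, hg, hglim⟩ := Lp.cauchy_complete_eLpNorm hp' hGmem hsum hcau
  have hul := hus.memLp_self
  have hvl : ∀ j, MemLp (v j) (ENNReal.ofReal p) (volume.restrict (Ioo 0 T)) := fun j =>
    (hvs j).memLp_self
  have hFlim : Tendsto (fun j => eLpNorm (fracInt a (v j) - fracInt a u) (ENNReal.ofReal p)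
      (volume.restrict (Ioo 0 T))) atTop (𝓝 0) := by
    have hlim : Tendsto (fun j => K * δ j) atTop (𝓝 0) := by
      simpa using ENNReal.Tendsto.const_mul hδlim (Or.inr hK)
    refine tendsto_of_tendsto_of_tendsto_of_le_of_le tendsto_const_nhds hlim
      (fun _ => zero_le) fun j => ?_
    calc eLpNorm (fracInt a (v j) - fracInt a u) (ENNReal.ofReal p) (volume.restrict (Ioo 0 T))
        = eLpNorm (fracInt a (u - v j)) (ENNReal.ofReal p) (volume.restrict (Ioo 0 T)) := by
          rw [eLpNorm_sub_comm]
          exact (eLpNorm_congr_ae (fracInt_sub_ae ha (integrableOn_of_memLp hp hul)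
            (integrableOn_of_memLp hp (hvl j)))).symm
      _ ≤ K * eLpNorm (u - v j) (ENNReal.ofReal p) (volume.restrict (Ioo 0 T)) :=
          HK _ (hul.1.sub (hvl j).1).aemeasurable
      _ ≤ K * δ j := by
          gcongr
          rw [← eLpNorm_congr_ae (hus.sub (hvs j)).weakDeriv_zero_ae_eq]
          exact (eLpNorm_weakDeriv_le_slobodeckiNorm hp _ (Nat.zero_le _)).trans (hvδ j).le
  refine ⟨g, hasWeakDeriv_of_tendsto hp (fun j => hmem _ (hvl j)) (hmem _ hul) hGmem hg hFlim hglim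
    fun j => (hv j).hasWeakDeriv_fracInt hT ha hk, hg, ?_⟩
  have hlim : Tendsto (fun j => C * (3 * (slobodeckiNorm T β p u + δ j)) +
      eLpNorm (fracInt a (V j) - g) (ENNReal.ofReal p) (volume.restrict (Ioo 0 T))) atTop
      (𝓝 (C * (3 * (slobodeckiNorm T β p u + 0)) + 0)) :=
    (ENNReal.Tendsto.const_mul (ENNReal.Tendsto.const_mul (tendsto_const_nhds.add hδlim)
      (Or.inr (by simp))) (Or.inr hC)).add hglim
  refine (ge_of_tendsto' hlim fun j => ?_).trans_eq (by rw [add_zero, add_zero]; ring)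
  calc eLpNorm g (ENNReal.ofReal p) (volume.restrict (Ioo 0 T))
      = eLpNorm (fracInt a (V j) - (fracInt a (V j) - g)) (ENNReal.ofReal p)
          (volume.restrict (Ioo 0 T)) := by rw [sub_sub_cancel]
    _ ≤ _ := eLpNorm_sub_le (hGmem j).1 ((hGmem j).1.sub hg.1) hp'
    _ ≤ _ := by
        gcongr
        refine (H _ (hv j)).trans ?_
        gcongr
        calc slobodeckiNorm T β p (v j) = slobodeckiNorm T β p (u - (u - v j)) := by
              rw [sub_sub_cancel]
          _ ≤ 3 * (slobodeckiNorm T β p u + slobodeckiNorm T β p (u - v j)) :=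
              slobodeckiNorm_sub_le hp hus (hus.sub (hvs j))
          _ ≤ _ := by gcongr; exact (hvδ j).le

end FracSobolev

theorem lemma2p4 (T : ℝ) (hT : 0 < T) (p : ℝ) (hp : 1 ≤ p)
    (m : ℕ) (hm : 1 ≤ m) (σ α ε : ℝ) (hσ0 : 0 < σ) (hσ1 : σ < 1)
    (hα : α = (m : ℝ) - 1 + σ) (hε0 : 0 < ε) (hε1 : ε < 1 - σ) :
    ∃ C : ℝ, 0 < C ∧ ∀ u : ℝ → ℝ, FracSobolev.MemZeroSlobodecki T (α + ε) p u →
      FracSobolev.MemSobolev T m p (FracSobolev.fracInt ((m : ℝ) - α) u) ∧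
      FracSobolev.sobolevNorm T m p (FracSobolev.fracInt ((m : ℝ) - α) u) ≤
        ENNReal.ofReal C * FracSobolev.slobodeckiNorm T (α + ε) p u := by
  open FracSobolev in
  obtain ⟨n, rfl⟩ : ∃ n, m = n + 1 := ⟨m - 1, by omega⟩
  have hβ : α + ε = (n : ℝ) + (σ + ε) := by rw [hα]; push_cast; ring
  have hfloor : ⌊α + ε⌋₊ = n := by
    rw [hβ, Nat.floor_eq_iff (by positivity)]
    constructor <;> linarith
  have hfract : Int.fract (α + ε) = σ + ε := by
    rw [hβ, Int.fract_natCast_add, Int.fract_eq_self]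
    constructor <;> linarith
  have ha : ((n + 1 : ℕ) : ℝ) - α = 1 - σ := by rw [hα]; ring
  rw [ha]
  have hC : ∀ k : ℕ, ∃ C : ℝ≥0∞, C ≠ ⊤ ∧ (k ≤ n + 1 → ∀ v : ℝ → ℝ,
      MemZeroC T (⌊α + ε⌋₊ + 1) v →
      eLpNorm (fracInt (1 - σ) (iteratedDerivWithin k v (Icc 0 T))) (ENNReal.ofReal p)
        (volume.restrict (Ioo 0 T)) ≤ C * slobodeckiNorm T (α + ε) p v) := by
    intro k
    by_cases hk : k ≤ n + 1
    · obtain ⟨C, hC, H⟩ := exists_eLpNorm_fracInt_iteratedDeriv_le (β := α + ε) hT hp hσ0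
        (by rw [hfract]; linarith) (k := k) (by rwa [hfloor])
      exact ⟨C, hC, fun _ => H⟩
    · exact ⟨0, by simp, fun h => absurd h hk⟩
  choose C hCt H using hC
  set S : ℝ≥0∞ := ∑ k ∈ Finset.range (n + 1 + 1), 3 * C k with hS
  have hSt : S ≠ ⊤ := ENNReal.sum_ne_top.2 fun k _ => ENNReal.mul_ne_top (by simp) (hCt k)
  refine ⟨S.toReal + 1, by positivity, fun u hu => ?_⟩
  have key : ∀ k ≤ n + 1, ∃ g, HasWeakDeriv T k (fracInt (1 - σ) u) g ∧
      MemLp g (ENNReal.ofReal p) (volume.restrict (Ioo 0 T)) ∧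
      eLpNorm g (ENNReal.ofReal p) (volume.restrict (Ioo 0 T)) ≤
        3 * C k * slobodeckiNorm T (α + ε) p u := fun k hk =>
    exists_hasWeakDeriv_fracInt_le hT hp (by linarith) (by rwa [hfloor]) (hCt k) (H k hk) hu
  refine ⟨fun k hk => ?_, ?_⟩
  · obtain ⟨g, hg, hg', -⟩ := key k hk
    exact ⟨g, hg, hg'⟩
  · calc sobolevNorm T (n + 1) p (fracInt (1 - σ) u)
        ≤ ∑ k ∈ Finset.range (n + 1 + 1), 3 * C k * slobodeckiNorm T (α + ε) p u := by
          refine Finset.sum_le_sum fun k hk => ?_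
          obtain ⟨g, hg, -, hle⟩ := key k (Nat.lt_succ_iff.1 (Finset.mem_range.1 hk))
          rwa [eLpNorm_congr_ae hg.weakDeriv_ae_eq]
      _ = S * slobodeckiNorm T (α + ε) p u := by rw [hS, Finset.sum_mul]
      _ ≤ _ := by
          gcongr
          rw [ENNReal.le_ofReal_iff_toReal_le hSt (by positivity)]
          linarith
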